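/- Work on a real random access machine: the memory consists of arrays of natural numbers and of arrays of real numbers, and reading or writing a cell (at a computed index), addition, (truncated) subtraction and comparison of two naturals or of two reals each take one unit of time. Let $B=(V\uplus U,E)$ be a bipartite graph with edge weights $w:E\to\mathbb R$, where $V=\{v_1,\dots,v_k\}$, $U=\{u_1,\dots,u_l\}$ and $l\ge 2$; it is given by $k$, $l$, its $k\times l$ adjacency matrix and the weights of its edges. For each $j\in\{1,\dots,l\}$ let $B_j:=B[V\uplus (U\setminus\{u_j\})]$ be the induced subgraph obtained by deleting $u_j$. A maximum weight matching of a weighted graph is a set $M$ of pairwise vertex-disjoint edges for which $\sum_{e\in M}w(e)$ is as large as possible among all such sets (it need not be perfect). There is a single algorithm which, for every such input, computes a maximum weight matching of each of the $l+1$ graphs $B,B_1,\dots,B_l$ (and writes all of them out), and whose total running time for $k\ge 1$ is $$\mathcal O\bigl(k\,l\,(\min\{k,l\}+\log\max\{k,l\})\bigr),$$ where the constant does not depend on $k$, $l$, $B$ and $w$. -/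

import Mathlib

/-! ### Matchings in weighted graphs -/

/-- A matching of (a subgraph `H` of) a graph: a finite set of edges of `H`, no two of which share
a vertex. -/
def IsEdgeMatching {X : Type*} {G : SimpleGraph X} (H : G.Subgraph) (M : Finset (Sym2 X)) : Prop :=
  (∀ e ∈ M, e ∈ H.edgeSet) ∧ ∀ e ∈ M, ∀ f ∈ M, ∀ x : X, x ∈ e → x ∈ f → e = f

/-- A maximum weight matching of `H` with respect to the edge weights `w`
(only the values of `w` on edges of `H` matter). -/
def IsMaxWeightMatching {X : Type*} {G : SimpleGraph X} (H : G.Subgraph) (w : Sym2 X → ℝ)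
    (M : Finset (Sym2 X)) : Prop :=
  IsEdgeMatching H M ∧
    ∀ M' : Finset (Sym2 X), IsEdgeMatching H M' → ∑ e ∈ M', w e ≤ ∑ e ∈ M, w e

/-! ### A real random access machine

The memory consists of unbounded arrays of natural numbers and of real numbers, addressed
by an array name, which is fixed in the program text, and an index, which may be computed.
A program is a finite text, hence it uses finitely many arrays. The elementary operations are reading
and writing a cell, addition, (truncated) subtraction and comparison, each of unit cost.
There is no multiplication, no division, no rounding, and no conversion between reals and naturals. -/

namespace RealRAM

/-- The memory: `nat a i` and `real a i` are the contents of cell `i` of array `a`. -/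
structure State where
  nat : ℕ → ℕ → ℕ
  real : ℕ → ℕ → ℝ

/-- Write `v` to cell `i` of the array `a` of naturals. -/
def State.setNat (s : State) (a i v : ℕ) : State :=
  { s with nat := Function.update s.nat a (Function.update (s.nat a) i v) }

/-- Write `v` to cell `i` of the array `a` of reals. -/
def State.setReal (s : State) (a i : ℕ) (v : ℝ) : State :=
  { s with real := Function.update s.real a (Function.update (s.real a) i v) }

/-- Expressions for natural numbers. -/
inductive NatExpr where
  | const (n : ℕ)
  | read (a : ℕ) (i : NatExpr)
  | add (e f : NatExpr)
  | sub (e f : NatExpr)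

def NatExpr.eval (s : State) : NatExpr → ℕ
  | .const n => n
  | .read a i => s.nat a (i.eval s)
  | .add e f => e.eval s + f.eval s
  | .sub e f => e.eval s - f.eval s

/-- The number of elementary operations of an evaluation. -/
def NatExpr.cost : NatExpr → ℕ
  | .const _ => 1
  | .read _ i => i.cost + 1
  | .add e f => e.cost + f.cost + 1
  | .sub e f => e.cost + f.cost + 1

/-- Expressions for real numbers. The only real constant is `0`. -/
inductive RealExpr where
  | zero
  | read (a : ℕ) (i : NatExpr)
  | add (e f : RealExpr)
  | sub (e f : RealExpr)

noncomputable def RealExpr.eval (s : State) : RealExpr → ℝ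
  | .zero => 0
  | .read a i => s.real a (i.eval s)
  | .add e f => e.eval s + f.eval s
  | .sub e f => e.eval s - f.eval s

def RealExpr.cost : RealExpr → ℕ
  | .zero => 1
  | .read _ i => i.cost + 1
  | .add e f => e.cost + f.cost + 1
  | .sub e f => e.cost + f.cost + 1

/-- Tests: comparisons of naturals and of reals, and their Boolean combinations. -/
inductive Test where
  | natLt (e f : NatExpr)
  | realLt (e f : RealExpr)
  | neg (b : Test)
  | conj (b c : Test)

def Test.Holds (s : State) : Test → Prop
  | .natLt e f => e.eval s < f.eval s
  | .realLt e f => e.eval s < f.eval s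
  | .neg b => ¬ b.Holds s
  | .conj b c => b.Holds s ∧ c.Holds s

def Test.cost : Test → ℕ
  | .natLt e f => e.cost + f.cost + 1
  | .realLt e f => e.cost + f.cost + 1
  | .neg b => b.cost + 1
  | .conj b c => b.cost + c.cost + 1

/-- Programs. `natSet a i e` writes the value of `e` to cell `i` of array `a`;
`loop b p` is the loop "while `b` do `p`". -/
inductive Program where
  | skip
  | natSet (a : ℕ) (i e : NatExpr)
  | realSet (a : ℕ) (i : NatExpr) (e : RealExpr)
  | seq (p q : Program)
  | branch (b : Test) (p q : Program)
  | loop (b : Test) (p : Program)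

/-- `Exec p s t s'`: started in the memory state `s`, the program `p` halts after
exactly `t` elementary operations in the memory state `s'`. -/
inductive Exec : Program → State → ℕ → State → Prop
  | skip (s : State) : Exec .skip s 1 s
  | natSet (a : ℕ) (i e : NatExpr) (s : State) :
      Exec (.natSet a i e) s (i.cost + e.cost + 1) (s.setNat a (i.eval s) (e.eval s))
  | realSet (a : ℕ) (i : NatExpr) (e : RealExpr) (s : State) :
      Exec (.realSet a i e) s (i.cost + e.cost + 1) (s.setReal a (i.eval s) (e.eval s))
  | seq {p q : Program} {s s' s'' : State} {t t' : ℕ} :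
      Exec p s t s' → Exec q s' t' s'' → Exec (.seq p q) s (t + t') s''
  | branch_true {b : Test} {p q : Program} {s s' : State} {t : ℕ} :
      b.Holds s → Exec p s t s' → Exec (.branch b p q) s (b.cost + t + 1) s'
  | branch_false {b : Test} {p q : Program} {s s' : State} {t : ℕ} :
      ¬ b.Holds s → Exec q s t s' → Exec (.branch b p q) s (b.cost + t + 1) s'
  | loop_true {b : Test} {p : Program} {s s' s'' : State} {t t' : ℕ} :
      b.Holds s → Exec p s t s' → Exec (.loop b p) s' t' s'' →
        Exec (.loop b p) s (b.cost + t + t' + 1) s''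
  | loop_false {b : Test} {p : Program} {s : State} :
      ¬ b.Holds s → Exec (.loop b p) s (b.cost + 1) s

/-- Execution is deterministic: running time and final memory are functions of the initial memory. -/
theorem Exec.deterministic {p : Program} {s s₁ : State} {t₁ : ℕ} (h₁ : Exec p s t₁ s₁) :
    ∀ {t₂ : ℕ} {s₂ : State}, Exec p s t₂ s₂ → t₁ = t₂ ∧ s₁ = s₂ := by
  induction h₁ with
  | skip | natSet | realSet => intro t₂ s₂ h₂; cases h₂; exact ⟨rfl, rfl⟩
  | seq _ _ ih ih' =>
    intro t₂ s₂ h₂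
    cases h₂ with
    | seq h h' =>
      obtain ⟨rfl, rfl⟩ := ih h
      obtain ⟨rfl, rfl⟩ := ih' h'
      exact ⟨rfl, rfl⟩
  | branch_true hb _ ih | branch_false hb _ ih =>
    intro t₂ s₂ h₂
    cases h₂ with
    | branch_true hb' h => first | exact absurd hb' hb | (obtain ⟨rfl, rfl⟩ := ih h; exact ⟨rfl, rfl⟩)
    | branch_false hb' h => first | exact absurd hb hb' | (obtain ⟨rfl, rfl⟩ := ih h; exact ⟨rfl, rfl⟩)
  | loop_true hb _ _ ih ih' =>
    intro t₂ s₂ h₂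
    cases h₂ with
    | loop_true _ h h' =>
      obtain ⟨rfl, rfl⟩ := ih h
      obtain ⟨rfl, rfl⟩ := ih' h'
      exact ⟨rfl, rfl⟩
    | loop_false hb' => exact absurd hb hb'
  | loop_false hb =>
    intro t₂ s₂ h₂
    cases h₂ with
    | loop_true hb' _ _ => exact absurd hb' hb
    | loop_false _ => exact ⟨rfl, rfl⟩

open Classical in
/-- The memory `s` holds the weighted bipartite graph `(B, w)` with sides `Fin k`, `Fin l` as input:
the cells 0 and 1 of the array 0 of naturals contain `k` and `l`, the array 1 of naturals contains
the bipartite adjacency matrix in row-major order, and the array 0 of reals contains, in the same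
order, the weights of the edges. Nothing is known about the other cells. -/
def HoldsInput {k l : ℕ} (B : SimpleGraph (Fin k ⊕ Fin l)) (w : Sym2 (Fin k ⊕ Fin l) → ℝ)
    (s : State) : Prop :=
  s.nat 0 0 = k ∧ s.nat 0 1 = l ∧
  (∀ (i : Fin k) (j : Fin l), s.nat 1 (i * l + j) = if B.Adj (.inl i) (.inr j) then 1 else 0) ∧
  ∀ (i : Fin k) (j : Fin l), B.Adj (.inl i) (.inr j) → s.real 0 (i * l + j) = w s(.inl i, .inr j)

/-- The `r`-th edge set that the memory `s` contains as output. It is stored in the `k` cells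
`r * k, …, r * k + (k - 1)` of the array 2 of naturals: the cell `r * k + i` contains `j + 1` if the
vertex `i` of the left side is joined to the vertex `j` of the right side, and any
value outside `1, …, l` (for instance `0`) if the vertex `i` is not covered. -/
def State.output (k l : ℕ) (s : State) (r : ℕ) : Finset (Sym2 (Fin k ⊕ Fin l)) :=
  ((Finset.univ : Finset (Fin k × Fin l)).filter
    fun p => s.nat 2 (r * k + (p.1 : ℕ)) = (p.2 : ℕ) + 1).image
      fun p => s(Sum.inl p.1, Sum.inr p.2)

end RealRAM

/-! The algorithm is the Hungarian method, with one search routine used both for inserting rows and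
for deleting columns. Replace every weight by its positive part and non-edges by `0`, and add a sink
column `0` of weight `0` that any number of rows may share. Maximum weight matchings then correspond
to optimal assignments in which every row is assigned, and `y ≥ 0` is just dual feasibility at the
sink.

The invariant `Good` consists of feasible duals `y`, `z`, an assignment tight for them, and `z = 0`
on unassigned columns, with one column `b` exempt from tightness and from the last condition. Once
`b` carries no row, weak duality (`Good.sum_le`) shows that the assignment is optimal among those
avoiding `b`, and its positive edges form a maximum weight matching of the graph without `b`
(`Good.isMaxWeightMatching`).

Emptying `b` is a shortest augmenting path search. An alternating tree is rooted at `b`; dual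
updates by the least slack (`Tree.update`) make an outside column tight. If that column has a row,
both join the tree (`Tree.grow`); otherwise the path from it back to `b` is flipped
(`Augmenting.step`). The sink always counts as free, so the search ends. Tree columns are nonzero
and own distinct rows, so there are at most `min k (l + 1)` growth steps, each costing `O(l)`
because the tree rows are reached through their columns.

A new row is inserted by assigning it to a virtual column `l + 1`, which is then emptied. After `k`
insertions the solution for `B` is saved. For `B_j` nothing has to be done if column `j` is
unassigned; otherwise one search from the saved solution suffices. At most `min k (l + 1)` columns
are assigned, so there are `O(k)` searches of cost `O(l * min k l)`, and all else is `O(k * l)`. The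
total is `O(k * l * min k l)`; the logarithm in the bound is mere slack. -/

namespace RealRAM

-- A program logic with running times.

attribute [simp] NatExpr.eval RealExpr.eval Test.Holds

section Memory

variable (s : State) (a b i v : ℕ) (x : ℝ)

@[simp] theorem State.setNat_real : (s.setNat a i v).real b = s.real b := rfl

@[simp] theorem State.setReal_nat : (s.setReal a i x).nat b = s.nat b := rfl

@[simp] theorem State.setNat_nat_self :
    (s.setNat a i v).nat a = Function.update (s.nat a) i v := by
  simp [State.setNat]

@[simp] theorem State.setReal_real_self :
    (s.setReal a i x).real a = Function.update (s.real a) i x := by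
  simp [State.setReal]

variable {a b}

@[simp] theorem State.setNat_nat_of_ne (h : b ≠ a) : (s.setNat a i v).nat b = s.nat b := by
  simp [State.setNat, h]

@[simp] theorem State.setReal_real_of_ne (h : b ≠ a) : (s.setReal a i x).real b = s.real b := by
  simp [State.setReal, h]

end Memory

/-- The arrays of naturals that a program may write to. -/
def Program.natWrites : Program → List ℕ
  | .skip => []
  | .natSet a _ _ => [a]
  | .realSet _ _ _ => []
  | .seq p q => p.natWrites ++ q.natWrites
  | .branch _ p q => p.natWrites ++ q.natWrites
  | .loop _ p => p.natWrites

/-- The arrays of reals that a program may write to. -/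
def Program.realWrites : Program → List ℕ
  | .skip => []
  | .natSet _ _ _ => []
  | .realSet a _ _ => [a]
  | .seq p q => p.realWrites ++ q.realWrites
  | .branch _ p q => p.realWrites ++ q.realWrites
  | .loop _ p => p.realWrites

/-- `s` and `s'` agree outside the arrays that `p` may write to. -/
def Agree (p : Program) (s s' : State) : Prop :=
  (∀ a, a ∉ p.natWrites → s'.nat a = s.nat a) ∧ ∀ a, a ∉ p.realWrites → s'.real a = s.real a

theorem Agree.refl (p : Program) (s : State) : Agree p s s := ⟨fun _ _ => rfl, fun _ _ => rfl⟩

theorem Agree.trans {p : Program} {s s' s'' : State} (h : Agree p s s') (h' : Agree p s' s'') :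
    Agree p s s'' :=
  ⟨fun a ha => (h'.1 a ha).trans (h.1 a ha), fun a ha => (h'.2 a ha).trans (h.2 a ha)⟩

theorem Agree.mono {p q : Program} {s s' : State} (h : Agree p s s')
    (hn : p.natWrites ⊆ q.natWrites) (hr : p.realWrites ⊆ q.realWrites) : Agree q s s' :=
  ⟨fun a ha => h.1 a fun h' => ha (hn h'), fun a ha => h.2 a fun h' => ha (hr h')⟩

/-- The frame rule: array names are fixed in the program text, so which arrays survive a program is
a syntactic question that `decide` settles. -/
theorem Exec.agree {p : Program} {s s' : State} {t : ℕ} (h : Exec p s t s') : Agree p s s' := by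
  induction h with
  | skip s => exact Agree.refl _ _
  | natSet a i e s =>
    exact ⟨fun b hb => by simp [Program.natWrites] at hb; simp [hb], fun b _ => rfl⟩
  | realSet a i e s =>
    exact ⟨fun b _ => rfl, fun b hb => by simp [Program.realWrites] at hb; simp [hb]⟩
  | seq _ _ ih ih' =>
    exact (ih.mono (by simp [Program.natWrites]) (by simp [Program.realWrites])).trans
      (ih'.mono (by simp [Program.natWrites]) (by simp [Program.realWrites]))
  | branch_true _ _ ih => exact ih.mono (by simp [Program.natWrites]) (by simp [Program.realWrites])
  | branch_false _ _ ih => exact ih.mono (by simp [Program.natWrites]) (by simp [Program.realWrites])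
  | loop_true _ _ _ ih ih' =>
    exact (ih.mono (by simp [Program.natWrites]) (by simp [Program.realWrites])).trans ih'
  | loop_false _ => exact Agree.refl _ _

/-- Started in `s`, the program `p` halts within `T` steps in a state satisfying `Q`. -/
def Runs (p : Program) (s : State) (T : ℕ) (Q : State → Prop) : Prop :=
  ∃ t s', Exec p s t s' ∧ t ≤ T ∧ Q s'

theorem Runs.mono {p : Program} {s : State} {T T' : ℕ} {Q Q' : State → Prop} (h : Runs p s T Q)
    (hT : T ≤ T') (hQ : ∀ s', Agree p s s' → Q s' → Q' s') : Runs p s T' Q' := by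
  obtain ⟨t, s', he, ht, hq⟩ := h
  exact ⟨t, s', he, ht.trans hT, hQ s' he.agree hq⟩

theorem Runs.seq {p q : Program} {s : State} {T T' : ℕ} {Q R : State → Prop} (h : Runs p s T Q)
    (h' : ∀ s', Agree p s s' → Q s' → Runs q s' T' R) : Runs (.seq p q) s (T + T') R := by
  obtain ⟨t, s', he, ht, hq⟩ := h
  obtain ⟨t', s'', he', ht', hr⟩ := h' s' he.agree hq
  exact ⟨t + t', s'', he.seq he', by omega, hr⟩

theorem Runs.branch {b : Test} {p q : Program} {s : State} {T T' : ℕ} {Q : State → Prop}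
    (h : b.Holds s → Runs p s T Q) (h' : ¬ b.Holds s → Runs q s T Q) (hT : b.cost + T + 1 ≤ T') :
    Runs (.branch b p q) s T' Q := by
  by_cases hb : b.Holds s
  · obtain ⟨t, s', he, ht, hq⟩ := h hb
    exact ⟨_, s', .branch_true hb he, by omega, hq⟩
  · obtain ⟨t, s', he, ht, hq⟩ := h' hb
    exact ⟨_, s', .branch_false hb he, by omega, hq⟩

/-- A loop whose variant `v` decreases halts. -/
theorem Runs.loop {b : Test} {p : Program} {s : State} (I : State → Prop) (v : State → ℕ)
    (T n : ℕ) (hI : I s) (hn : v s ≤ n)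
    (hb : ∀ s', Agree (.loop b p) s s' → I s' → b.Holds s' →
      Runs p s' T fun s'' => I s'' ∧ v s'' < v s') :
    Runs (.loop b p) s ((n + 1) * (b.cost + T + 1)) fun s' => I s' ∧ ¬ b.Holds s' := by
  induction n generalizing s with
  | zero =>
    have hb' : ¬ b.Holds s := fun h => by
      obtain ⟨_, _, _, _, _, h'⟩ := hb s (Agree.refl _ _) hI h
      omega
    exact ⟨_, s, .loop_false hb', by omega, hI, hb'⟩
  | succ n ih =>
    by_cases hs : b.Holds s
    · obtain ⟨t, s', he, ht, hI', hv⟩ := hb s (Agree.refl _ _) hI hs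
      obtain ⟨t', s'', he', ht', h⟩ := ih hI' (by omega) fun s'' h'' =>
        hb s'' (Agree.trans (p := .loop b p) ⟨he.agree.1, he.agree.2⟩ h'')
      refine ⟨_, s'', .loop_true hs he he', ?_, h⟩
      calc b.cost + t + t' + 1 ≤ (n + 1) * (b.cost + T + 1) + (b.cost + T + 1) := by omega
        _ = _ := by ring
    · refine ⟨_, s, .loop_false hs, ?_, hI, hs⟩
      calc b.cost + 1 ≤ b.cost + T + 1 := by omega
        _ ≤ _ := Nat.le_mul_of_pos_left _ (by omega)

/-- The program contains no loop. -/
def Program.loopFree : Program → Bool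
  | .skip | .natSet _ _ _ | .realSet _ _ _ => true
  | .seq p q | .branch _ p q => p.loopFree && q.loopFree
  | .loop _ _ => false

/-- The worst case running time of a program without loops. -/
def Program.bound : Program → ℕ
  | .skip => 1
  | .natSet _ i e => i.cost + e.cost + 1
  | .realSet _ i e => i.cost + e.cost + 1
  | .seq p q => p.bound + q.bound
  | .branch b p q => b.cost + max p.bound q.bound + 1
  | .loop _ _ => 0

open Classical in
/-- The effect of a program without loops. -/
noncomputable def Program.exec : Program → State → State
  | .skip, s => s
  | .natSet a i e, s => s.setNat a (i.eval s) (e.eval s)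
  | .realSet a i e, s => s.setReal a (i.eval s) (e.eval s)
  | .seq p q, s => q.exec (p.exec s)
  | .branch b p q, s => if b.Holds s then p.exec s else q.exec s
  | .loop _ _, s => s

attribute [simp] Program.exec

/-- Reduces straight-line code to simplifying `exec` and deciding a numerical inequality for
`bound`. -/
theorem Program.exists_exec (p : Program) (hp : p.loopFree = true) (s : State) :
    ∃ t, Exec p s t (p.exec s) ∧ t ≤ p.bound := by
  induction p generalizing s with
  | skip => exact ⟨_, .skip s, le_rfl⟩
  | natSet a i e => exact ⟨_, .natSet a i e s, le_rfl⟩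
  | realSet a i e => exact ⟨_, .realSet a i e s, le_rfl⟩
  | seq p q ihp ihq =>
    simp only [Program.loopFree, Bool.and_eq_true] at hp
    obtain ⟨t, h, ht⟩ := ihp hp.1 s
    obtain ⟨t', h', ht'⟩ := ihq hp.2 (p.exec s)
    exact ⟨_, h.seq h', by simp only [Program.bound]; omega⟩
  | branch b p q ihp ihq =>
    simp only [Program.loopFree, Bool.and_eq_true] at hp
    by_cases hb : b.Holds s
    · obtain ⟨t, h, ht⟩ := ihp hp.1 s
      refine ⟨_, by simpa only [Program.exec, if_pos hb] using Exec.branch_true hb h, ?_⟩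
      simp only [Program.bound]; omega
    · obtain ⟨t, h, ht⟩ := ihq hp.2 s
      refine ⟨_, by simpa only [Program.exec, if_neg hb] using Exec.branch_false hb h, ?_⟩
      simp only [Program.bound]; omega
  | loop b p => simp [Program.loopFree] at hp

theorem Runs.of_exec {p : Program} {s : State} {T : ℕ} {Q : State → Prop}
    (hp : p.loopFree = true) (hT : p.bound ≤ T) (hQ : Q (p.exec s)) : Runs p s T Q := by
  obtain ⟨t, h, ht⟩ := p.exists_exec hp s
  exact ⟨t, _, h, ht.trans hT, hQ⟩

/-- The scalar variable that is stored in cell `0` of array `a`. -/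
abbrev var (a : ℕ) : NatExpr := .read a (.const 0)

/-- Assignment to a scalar variable. -/
abbrev assign (a : ℕ) (e : NatExpr) : Program := .natSet a (.const 0) e

/-- The loop "for `x = 0, …, e - 1` do `p`". -/
abbrev forLoop (x : ℕ) (e : NatExpr) (p : Program) : Program :=
  .seq (assign x (.const 0))
    (.loop (.natLt (var x) e) (.seq p (assign x (.add (var x) (.const 1)))))

/-- The bound `T m` may depend on the iteration; this is needed for the deletion phase, where only
few iterations are expensive. The invariant `I m` speaks of the state whose counter is already `m`.
-/
theorem Runs.forLoop {x : ℕ} {e : NatExpr} {p : Program} {s : State} (N : ℕ) (T : ℕ → ℕ)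
    (I : ℕ → State → Prop) {Q : State → Prop}
    (hx : x ∉ p.natWrites)
    (he : ∀ s', Agree (RealRAM.forLoop x e p) s s' → e.eval s' = N)
    (h0 : I 0 (s.setNat x 0 0))
    (hp : ∀ m s', m < N → Agree (RealRAM.forLoop x e p) s s' → s'.nat x 0 = m → I m s' →
      Runs p s' (T m) fun s'' => I (m + 1) (s''.setNat x 0 (m + 1)))
    (hQ : ∀ s', I N s' → Q s') :
    Runs (RealRAM.forLoop x e p) s
      (∑ m ∈ Finset.range N, (T m + (e.cost + 10)) + (e.cost + 10)) Q := by
  set body : Program := .seq p (assign x (.add (var x) (.const 1))) with hbody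
  have key : ∀ n m s', n + m = N → Agree (RealRAM.forLoop x e p) s s' → s'.nat x 0 = m → I m s' →
      Runs (.loop (.natLt (var x) e) body) s'
        (∑ i ∈ Finset.Ico m N, (T i + (e.cost + 10)) + (e.cost + 4)) (I N) := by
    intro n
    induction n with
    | zero =>
      intro m s' hm hA hv hI
      have : ¬ (Test.natLt (var x) e).Holds s' := by simp [he s' hA, hv]; omega
      refine ⟨_, s', .loop_false this, ?_, ?_⟩
      · simp [Test.cost, NatExpr.cost]; omega
      · rwa [show m = N by omega] at hI
    | succ n ih =>
      intro m s' hm hA hv hI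
      have hlt : (Test.natLt (var x) e).Holds s' := by simp [he s' hA, hv]; omega
      obtain ⟨t, s₁, h₁, ht, hI₁⟩ := hp m s' (by omega) hA hv hI
      have hv₁ : s₁.nat x 0 = m := by rw [h₁.agree.1 x hx, hv]
      have h₂ : Exec body s' (t + 6) (s₁.setNat x 0 (m + 1)) := by
        have := Exec.natSet x (.const 0) (.add (var x) (.const 1)) s₁
        simp only [NatExpr.eval, hv₁, NatExpr.cost] at this
        exact h₁.seq this
      obtain ⟨t', s₂, h₃, ht', hI₂⟩ := ih (m + 1) (s₁.setNat x 0 (m + 1)) (by omega)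
        (hA.trans (h₂.agree.mono (by simp [body, Program.natWrites])
          (by simp [body, Program.realWrites]))) (by simp) hI₁
      refine ⟨_, s₂, .loop_true hlt h₂ h₃, ?_, hI₂⟩
      rw [Finset.sum_eq_sum_Ico_succ_bot (by omega)]
      simp only [Test.cost, NatExpr.cost]
      omega
  have h₀ : Exec (assign x (.const 0)) s 3 (s.setNat x 0 0) := Exec.natSet x (.const 0) (.const 0) s
  obtain ⟨t, s', h, ht, hI⟩ := key N 0 (s.setNat x 0 0) (by omega)
    (h₀.agree.mono (by simp [Program.natWrites]) (by simp [Program.realWrites])) (by simp) h0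
  refine ⟨_, s', h₀.seq h, ?_, hQ s' hI⟩
  rw [Finset.range_eq_Ico]
  omega

/-- A `for` loop with a body of constant cost. -/
theorem Runs.forLoop_const {x : ℕ} {e : NatExpr} {p : Program} {s : State} (N T : ℕ)
    (I : ℕ → State → Prop) {Q : State → Prop}
    (hx : x ∉ p.natWrites)
    (he : ∀ s', Agree (RealRAM.forLoop x e p) s s' → e.eval s' = N)
    (h0 : I 0 (s.setNat x 0 0))
    (hp : ∀ m s', m < N → Agree (RealRAM.forLoop x e p) s s' → s'.nat x 0 = m → I m s' →
      Runs p s' T fun s'' => I (m + 1) (s''.setNat x 0 (m + 1)))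
    (hQ : ∀ s', I N s' → Q s') :
    Runs (RealRAM.forLoop x e p) s ((N + 1) * (T + (e.cost + 10))) Q := by
  refine (Runs.forLoop N (fun _ => T) I hx he h0 hp hQ).mono ?_ fun _ _ h => h
  simp only [Finset.sum_const, Finset.card_range, smul_eq_mul]
  nlinarith

end RealRAM

/-! ### Dual certificates and alternating trees. -/

namespace Hungarian

/-- Optimal duals `y`, `z` and an assignment `q` of the rows `i < R` to columns, with inverse `p`.
Column `0` is a sink which may be used by any number of rows. Nothing is required of the
column `b`: it is about to be deleted. -/
structure Good (k l R b : ℕ) (W : ℕ → ℕ → ℝ) (y z : ℕ → ℝ) (p q : ℕ → ℕ) : Prop where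
  le_rows : R ≤ k
  feas : ∀ i < k, ∀ j ≤ l, W i j ≤ y i + z j
  z_zero : z 0 = 0
  z_nonneg : ∀ j ≤ l, 0 ≤ z j
  q_le : ∀ i < R, q i ≤ l + 1
  tight : ∀ i < R, q i ≠ b → q i ≤ l ∧ W i (q i) = y i + z (q i)
  p_iff : ∀ j, j ≠ 0 → j ≤ l + 1 → ∀ i, p j = i + 1 ↔ i < R ∧ q i = j
  free : ∀ j ≤ l, j ≠ b → p j = 0 → z j = 0
  p_zero : p 0 = 0

variable {k l R b : ℕ} {W : ℕ → ℕ → ℝ} {y z slack : ℕ → ℝ} {p q used way ρ : ℕ → ℕ}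

/-- The alternating tree with root `b`, consisting of the columns `j` with `0 < used j` and
the rows assigned to them; `ρ` is the order in which the columns were added. -/
structure Tree (l R b n : ℕ) (W : ℕ → ℕ → ℝ) (y z slack : ℕ → ℝ) (q used way ρ : ℕ → ℕ) :
    Prop where
  root : 0 < used b
  row : ∀ j ≤ l + 1, 0 < used j → j ≠ 0 ∧ ρ j < n ∧ ∃ i < R, q i = j
  parent : ∀ j ≤ l + 1, 0 < used j → j ≠ b → j ≤ l ∧
    ∃ i < R, q i = way j ∧ 0 < used (way j) ∧ ρ (way j) < ρ j ∧ W i j = y i + z j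
  slack_le : ∀ j ≤ l, used j = 0 → ∀ i < R, 0 < used (q i) → slack j ≤ y i + z j - W i j
  slack_eq : ∀ j ≤ l, used j = 0 →
    ∃ i < R, q i = way j ∧ 0 < used (way j) ∧ slack j = y i + z j - W i j
  card : ((Finset.range (l + 2)).filter fun j => 0 < used j).card = n

/-- Away from the sink `p` inverts `q`, so a column determines its row. -/
theorem Good.q_inj (h : Good k l R b W y z p q) {i i' : ℕ} (hi : i < R) (hi' : i' < R)
    (h0 : q i ≠ 0) (he : q i = q i') : i = i' := by
  have h1 := (h.p_iff (q i) h0 (h.q_le i hi) i).2 ⟨hi, rfl⟩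
  have h2 := (h.p_iff (q i) h0 (h.q_le i hi) i').2 ⟨hi', he.symm⟩
  omega

/-- Tree columns are images of rows under `q`, and the sink is never among them. This bounds the
number of growth steps of a search. -/
theorem Tree.size_le {n : ℕ} (h : Tree l R b n W y z slack q used way ρ) :
    n ≤ R ∧ n ≤ l + 1 := by
  constructor
  · rw [← h.card, ← Finset.card_range R]
    refine (Finset.card_le_card ?_).trans (Finset.card_image_le (s := Finset.range R) (f := q))
    intro j hj
    simp only [Finset.mem_filter, Finset.mem_range] at hj
    obtain ⟨-, -, i, hi, hq⟩ := h.row j (by omega) hj.2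
    exact Finset.mem_image.2 ⟨i, Finset.mem_range.2 hi, hq⟩
  · rw [← h.card]
    have : ((Finset.range (l + 2)).filter fun j => 0 < used j) ⊆ (Finset.range (l + 2)).erase 0 := by
      intro j hj
      simp only [Finset.mem_filter, Finset.mem_range] at hj
      obtain ⟨h0, -⟩ := h.row j (by omega) hj.2
      simp [h0, hj.1]
    exact (Finset.card_le_card this).trans (by simp)

theorem Tree.init (hg : Good k l R b W y z p q) (hb : b ≠ 0) (hbl : b ≤ l + 1) {i : ℕ}
    (hp : p b = i + 1) (hu : ∀ j ≤ l + 1, used j = if j = b then 1 else 0)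
    (hw : ∀ j ≤ l, way j = b) (hs : ∀ j ≤ l, slack j = y i + z j - W i j) :
    Tree l R b 1 W y z slack q used way (fun _ => 0) := by
  obtain ⟨hi, hq⟩ := (hg.p_iff b hb hbl i).1 hp
  have hub : 0 < used b := by simp [hu b hbl]
  have only : ∀ j ≤ l + 1, 0 < used j → j = b := fun j hj h => by
    by_contra hne
    simp [hu j hj, hne] at h
  refine ⟨hub, fun j hj h => ?_, fun j hj h hne => absurd (only j hj h) hne, ?_, ?_, ?_⟩
  · obtain rfl := only j hj h
    exact ⟨hb, Nat.one_pos, i, hi, hq⟩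
  · intro j hj _ i' hi' h
    have := only _ (hg.q_le i' hi') h
    obtain rfl : i' = i := hg.q_inj hi' hi (by omega) (by omega)
    exact (hs j hj).le
  · intro j hj _
    exact ⟨i, hi, by rw [hw j hj, hq], by rwa [hw j hj], hs j hj⟩
  · have : ((Finset.range (l + 2)).filter fun j => 0 < used j) = {b} := by
      ext j
      simp only [Finset.mem_filter, Finset.mem_range, Finset.mem_singleton]
      exact ⟨fun h => only j (by omega) h.2, fun h => by subst h; exact ⟨by omega, hub⟩⟩
    rw [this, Finset.card_singleton]

/-- The dual update by the least slack. -/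
theorem Tree.update {n t : ℕ} {y' z' slack' : ℕ → ℝ} (hg : Good k l R b W y z p q)
    (h : Tree l R b n W y z slack q used way ρ) (htl : t ≤ l) (hut : used t = 0)
    (ht : ∀ j ≤ l, used j = 0 → slack t ≤ slack j)
    (hy : ∀ i < k, y' i = if i < R ∧ 0 < used (q i) then y i - slack t else y i)
    (hz : ∀ j ≤ l + 1, z' j = if 0 < used j then z j + slack t else z j)
    (hs : ∀ j ≤ l, used j = 0 → slack' j = slack j - slack t) :
    Good k l R b W y' z' p q ∧ Tree l R b n W y' z' slack' q used way ρ ∧ slack' t = 0 := by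
  -- The slack is the reduced cost of an actual pair, hence nonnegative by feasibility.
  have hδ : 0 ≤ slack t := by
    obtain ⟨i, hi, -, -, he⟩ := h.slack_eq t htl hut
    have := hg.feas i (by have := hg.le_rows; omega) t htl
    linarith
  have hR := hg.le_rows
  have hu0 : used 0 = 0 := by
    by_contra h0
    exact (h.row 0 (by omega) (by omega)).1 rfl
  refine ⟨⟨hR, ?_, ?_, ?_, hg.q_le, ?_, hg.p_iff, ?_, hg.p_zero⟩, ⟨h.root, h.row, ?_, ?_, ?_, h.card⟩, ?_⟩
  · intro i hi j hj
    have hf := hg.feas i hi j hj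
    rw [hy i hi, hz j (by omega)]
    split_ifs with h1 h2 h2
    · linarith
    -- The only pairs whose reduced cost drops: tree row, outside column. Minimality of `slack t`
    -- keeps them feasible.
    · have := h.slack_le j hj (by omega) i h1.1 h1.2
      have := ht j hj (by omega)
      linarith
    · linarith
    · linarith
  · rw [hz 0 (by omega), if_neg (by omega), hg.z_zero]
  · intro j hj
    have := hg.z_nonneg j hj
    rw [hz j (by omega)]
    split_ifs <;> linarith
  · intro i hi hq
    obtain ⟨hl, he⟩ := hg.tight i hi hq
    refine ⟨hl, ?_⟩
    rw [hy i (by omega), hz _ (by omega), he]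
    by_cases hc : 0 < used (q i)
    · rw [if_pos ⟨hi, hc⟩, if_pos hc]; ring
    · rw [if_neg (fun h => hc h.2), if_neg hc]
  · intro j hj hjb hp
    rw [hz j (by omega), if_neg, hg.free j hj hjb hp]
    -- A tree column owns a row, so an unassigned column lies outside the tree and its dual stays
    -- `0`.
    intro hu
    obtain ⟨h0, -, i, hi, hq⟩ := h.row j (by omega) hu
    have := (hg.p_iff j h0 (by omega) i).2 ⟨hi, hq⟩
    omega
  · intro j hj hu hjb
    obtain ⟨hjl, i, hi, hq, hw, hr, he⟩ := h.parent j hj hu hjb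
    refine ⟨hjl, i, hi, hq, hw, hr, ?_⟩
    rw [hy i (by omega), hz j hj, if_pos ⟨hi, by rwa [hq]⟩, if_pos hu, he]; ring
  · intro j hj hu i hi hq
    rw [hs j hj hu, hy i (by omega), hz j (by omega), if_pos ⟨hi, hq⟩, if_neg (by omega)]
    linarith [h.slack_le j hj hu i hi hq]
  · intro j hj hu
    obtain ⟨i, hi, hq, hw, he⟩ := h.slack_eq j hj hu
    refine ⟨i, hi, hq, hw, ?_⟩
    rw [hs j hj hu, hy i (by omega), hz j (by omega), if_pos ⟨hi, by rwa [hq]⟩, if_neg (by omega), he]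
    ring
  · rw [hs t htl hut, sub_self]

/-- The tree grows by a column of slack `0` and the row `i₀` that is assigned to it. -/
theorem Tree.grow {n t i₀ : ℕ} {slack' : ℕ → ℝ} {used' way' : ℕ → ℕ}
    (hg : Good k l R b W y z p q)
    (h : Tree l R b n W y z slack q used way ρ) (htl : t ≤ l) (hut : used t = 0)
    (ht : slack t = 0) (hp : p t = i₀ + 1)
    (hu : ∀ j, used' j = Function.update used t 1 j)
    (hway : ∀ j ≤ l + 1, 0 < used' j → way' j = way j)
    (hs : ∀ j ≤ l, used' j = 0 → (slack' j = slack j ∧ way' j = way j ∧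
      slack j ≤ y i₀ + z j - W i₀ j) ∨ (slack' j = y i₀ + z j - W i₀ j ∧ way' j = t ∧
      y i₀ + z j - W i₀ j ≤ slack j)) :
    Tree l R b (n + 1) W y z slack' q used' way' (Function.update ρ t n) := by
  have ht0 : t ≠ 0 := fun h0 => by rw [h0, hg.p_zero] at hp; omega
  obtain ⟨hi₀, hq₀⟩ := (hg.p_iff t ht0 (by omega) i₀).1 hp
  have hut' : used' t = 1 := by simp [hu]
  have hne : ∀ j, j ≠ t → used' j = used j := fun j hj => by simp [hu, hj]
  have hmono : ∀ j, 0 < used j → 0 < used' j ∧ j ≠ t := fun j hj => by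
    have : j ≠ t := by rintro rfl; omega
    exact ⟨by rwa [hne j this], this⟩
  refine ⟨(hmono _ h.root).1, ?_, ?_, ?_, ?_, ?_⟩
  · intro j hj hj'
    by_cases hjt : j = t
    · subst hjt
      exact ⟨ht0, by simp, i₀, hi₀, hq₀⟩
    · rw [hne j hjt] at hj'
      obtain ⟨h1, h2, h3⟩ := h.row j hj hj'
      exact ⟨h1, by simp only [Function.update_of_ne hjt]; omega, h3⟩
  · intro j hj hj' hjb
    rw [hway j hj hj']
    by_cases hjt : j = t
    · subst hjt
      obtain ⟨i, hi, hq, hw, he⟩ := h.slack_eq j htl hut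
      obtain ⟨h1, h2⟩ := hmono _ hw
      obtain ⟨-, h3, -⟩ := h.row (way j) (by rw [← hq]; exact hg.q_le i hi) hw
      exact ⟨htl, i, hi, hq, h1, by simp [Function.update_of_ne h2, h3], by linarith⟩
    · rw [hne j hjt] at hj'
      obtain ⟨hjl, i, hi, hq, hw, hr, he⟩ := h.parent j hj hj' hjb
      obtain ⟨h1, h2⟩ := hmono _ hw
      exact ⟨hjl, i, hi, hq, h1, by simpa [Function.update_of_ne h2, Function.update_of_ne hjt], he⟩
  · intro j hj hj' i hi hqi
    have hjt : j ≠ t := by rintro rfl; omega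
    have huj : used j = 0 := by rwa [hne j hjt] at hj'
    by_cases hit : q i = t
    -- The row `i₀` is the only row that enters the tree with `t`, so it is the only new candidate
    -- in the minimum defining the slack.
    · obtain rfl : i = i₀ := hg.q_inj hi hi₀ (by omega) (by omega)
      rcases hs j hj hj' with ⟨h1, -, h2⟩ | ⟨h1, -, h2⟩ <;> linarith
    · rw [hne _ hit] at hqi
      have := h.slack_le j hj huj i hi hqi
      rcases hs j hj hj' with ⟨h1, -, h2⟩ | ⟨h1, -, h2⟩ <;> linarith
  · intro j hj hj'
    have hjt : j ≠ t := by rintro rfl; omega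
    have huj : used j = 0 := by rwa [hne j hjt] at hj'
    rcases hs j hj hj' with ⟨h1, h2, -⟩ | ⟨h1, h2, -⟩
    · obtain ⟨i, hi, hq, hw, he⟩ := h.slack_eq j hj huj
      exact ⟨i, hi, by rw [h2, hq], by rw [h2]; exact (hmono _ hw).1, by rw [h1, he]⟩
    · exact ⟨i₀, hi₀, by rw [h2, hq₀], by rw [h2]; omega, h1⟩
  · have : ((Finset.range (l + 2)).filter fun j => 0 < used' j) =
        insert t ((Finset.range (l + 2)).filter fun j => 0 < used j) := by
      ext j
      simp only [Finset.mem_filter, Finset.mem_range, Finset.mem_insert]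
      by_cases hjt : j = t
      · subst hjt
        simp [hut']; omega
      · simp [hjt, hne j hjt]
    rw [this, Finset.card_insert_of_notMem (by simp [hut]), h.card]

/-! ### Flipping an augmenting path. -/

/-- The intermediate stages of an augmentation: the column `c` is the end of an alternating
path to `b`, and no row is assigned to it. -/
structure Augmenting (l R b c : ℕ) (W : ℕ → ℕ → ℝ) (y z : ℕ → ℝ) (p q used way ρ : ℕ → ℕ) :
    Prop where
  le : c ≤ l + 1
  q_le : ∀ i < R, q i ≤ l + 1
  parent : ∀ j ≤ l + 1, j = c ∨ 0 < used j ∧ ρ j < ρ c → j ≠ b → j ≤ l ∧ way j ≠ 0 ∧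
    ∃ i < R, q i = way j ∧ 0 < used (way j) ∧ ρ (way j) < ρ j ∧ W i j = y i + z j
  p_iff : ∀ j, j ≠ 0 → j ≤ l + 1 → j ≠ c → ∀ i, p j = i + 1 ↔ i < R ∧ q i = j
  hole : c ≠ 0 → ∀ i < R, q i ≠ c
  tight : ∀ i < R, q i ≠ b → q i ≤ l ∧ W i (q i) = y i + z (q i)
  free : ∀ j ≤ l, j ≠ b → j ≠ c → j ≠ 0 → p j = 0 → z j = 0

/-- The tight free column `t` is the first hole; giving it time `n` places it after all tree
columns. If `t` is the sink, other rows may be assigned to it, which is why `hole` exempts `0`. -/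
theorem Tree.augmenting {n t : ℕ} (hg : Good k l R b W y z p q)
    (h : Tree l R b n W y z slack q used way ρ) (htl : t ≤ l) (hut : used t = 0)
    (ht : slack t = 0) (hp : p t = 0) :
    Augmenting l R b t W y z p q used way (Function.update ρ t n) := by
  have hne : ∀ j, 0 < used j → j ≠ t := by rintro j h1 rfl; omega
  refine ⟨by omega, hg.q_le, ?_, fun j h0 hj _ => hg.p_iff j h0 hj, ?_, hg.tight,
    fun j hj hjb _ _ => hg.free j hj hjb⟩
  · rintro j hj (rfl | ⟨hu, -⟩) hjb
    · obtain ⟨i, hi, hq, hw, he⟩ := h.slack_eq j htl hut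
      obtain ⟨h1, h2, -⟩ := h.row (way j) (by rw [← hq]; exact hg.q_le i hi) hw
      exact ⟨htl, h1, i, hi, hq, hw, by simpa [hne _ hw] using h2, by linarith⟩
    · obtain ⟨hjl, i, hi, hq, hw, hr, he⟩ := h.parent j hj hu hjb
      obtain ⟨h1, -⟩ := h.row (way j) (by rw [← hq]; exact hg.q_le i hi) hw
      exact ⟨hjl, h1, i, hi, hq, hw, by simpa [hne _ hw, hne _ hu] using hr, he⟩
  · intro h0 i hi hq
    have := (hg.p_iff t h0 (by omega) i).2 ⟨hi, hq⟩
    omega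

/-- The row of the parent column is tight at `c`, so moving it to `c` preserves tightness and moves
the hole to the parent. The insertion time of the hole decreases, which gives termination. The entry
of `p` at the new hole is stale, so `p_iff` excludes it. -/
theorem Augmenting.step {c : ℕ} (h : Augmenting l R b c W y z p q used way ρ) (hc : c ≠ b) :
    ρ (way c) < ρ c ∧ Augmenting l R b (way c) W y z (Function.update p c (p (way c)))
      (Function.update q (p (way c) - 1) c) used way ρ := by
  obtain ⟨hcl, hw0, i, hi, hq, hw, hr, he⟩ := h.parent c h.le (.inl rfl) hc
  have hwl : way c ≤ l + 1 := hq ▸ h.q_le i hi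
  have hwc : way c ≠ c := fun h' => by rw [h'] at hr; omega
  have hii : p (way c) = i + 1 := (h.p_iff _ hw0 hwl hwc i).2 ⟨hi, hq⟩
  rw [show p (way c) - 1 = i by omega]
  refine ⟨hr, hwl, ?_, ?_, ?_, ?_, ?_, ?_⟩
  · intro i' hi'
    rw [Function.update_apply]
    split_ifs
    · exact h.le
    · exact h.q_le i' hi'
  · intro j hj hj' hjb
    have hj2 : 0 < used j ∧ ρ j ≤ ρ (way c) := by
      rcases hj' with rfl | hj'
      · exact ⟨hw, le_rfl⟩
      · exact ⟨hj'.1, hj'.2.le⟩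
    obtain ⟨hjl, h0, i', hi', hq', hu', hr', he'⟩ :=
      h.parent j hj (.inr ⟨hj2.1, by omega⟩) hjb
    refine ⟨hjl, h0, i', hi', ?_, hu', hr', he'⟩
    -- The moved row came from `way c`, whereas a parent on the remaining path is strictly older
    -- than `way c`, so its row is untouched.
    rw [Function.update_of_ne, hq']
    rintro rfl
    rw [← hq, hq'] at hj2
    omega
  · intro j h0 hj hjw i'
    simp only [Function.update_apply]
    by_cases hjc : j = c
    · subst hjc
      rw [if_pos rfl, hii]
      by_cases hii' : i' = i
      · simp [hii', hi]
      · rw [if_neg hii']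
        exact ⟨fun h' => by omega, fun h' => absurd h'.2 (h.hole h0 i' h'.1)⟩
    · rw [if_neg hjc, h.p_iff j h0 hj hjc]
      by_cases hii' : i' = i
      · subst hii'
        rw [if_pos rfl, hq]
        exact ⟨fun h' => absurd h'.2.symm hjw, fun h' => absurd h'.2.symm hjc⟩
      · rw [if_neg hii']
  · intro _ i' hi'
    rw [Function.update_apply]
    split_ifs with hii'
    · exact hwc.symm
    · intro hq'
      have := (h.p_iff _ hw0 hwl hwc i').2 ⟨hi', hq'⟩
      omega
  · intro i' hi'
    rw [Function.update_apply]
    split_ifs with hii'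
    · subst hii'
      exact fun _ => ⟨hcl, he⟩
    · exact h.tight i' hi'
  · intro j hj hjb hjw h0 hpj
    by_cases hjc : j = c
    · subst hjc
      simp [hii] at hpj
    · rw [Function.update_of_ne hjc] at hpj
      exact h.free j hj hjb hjc h0 hpj

/-- When the hole reaches `b`, two entries of `p` need resetting: the stale one at `b`, and the one
at `0`, which was overwritten if the path started at the sink. -/
theorem Augmenting.good {p' q' p₀ : ℕ → ℕ} (h : Augmenting l R b b W y z p q used way ρ)
    (hg : Good k l R b W y z p' q') (hb : b ≠ 0)
    (hp : ∀ j, p₀ j = if j = 0 ∨ j = b then 0 else p j) :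
    Good k l R b W y z p₀ q := by
  refine ⟨hg.le_rows, hg.feas, hg.z_zero, hg.z_nonneg, h.q_le, h.tight, ?_, ?_, by simp [hp]⟩
  · intro j h0 hj i
    rw [hp]
    by_cases hjb : j = b
    · rw [if_pos (.inr hjb)]
      exact ⟨fun h' => by omega, fun h' => absurd (h'.2.trans hjb) (h.hole hb i h'.1)⟩
    · rw [if_neg (by tauto)]
      exact h.p_iff j h0 hj hjb i
  · intro j hj hjb hpj
    by_cases h0 : j = 0
    · rw [h0, hg.z_zero]
    · rw [hp, if_neg (by tauto)] at hpj
      exact h.free j hj hjb hjb h0 hpj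

/-! ### Changing the exempt column. -/

/-- The virtual column `l + 1` is used to insert a new row. -/
theorem Good.insert {p' q' : ℕ → ℕ} (h : Good k l R (l + 1) W y z p q) (hR : R < k)
    (hp : p (l + 1) = 0)
    (hp' : ∀ j, p' j = if j = l + 1 then R + 1 else p j)
    (hq' : ∀ i, q' i = if i = R then l + 1 else q i) :
    Good k l (R + 1) (l + 1) W y z p' q' := by
  refine ⟨hR, h.feas, h.z_zero, h.z_nonneg, ?_, ?_, ?_, ?_, ?_⟩
  · intro i hi
    rw [hq']
    split_ifs with h'
    · rfl
    · exact h.q_le i (by omega)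
  · intro i hi
    rw [hq']
    split_ifs with h'
    · exact fun h'' => absurd rfl h''
    · exact h.tight i (by omega)
  · intro j h0 hj i
    rw [hp', hq']
    by_cases hjl : j = l + 1
    · rw [if_pos hjl]
      by_cases hi : i = R
      · simp [hi, hjl]
      · rw [if_neg hi]
        refine ⟨fun h' => by omega, fun h' => ?_⟩
        have := (h.p_iff j h0 hj i).2 ⟨by omega, h'.2⟩
        rw [hjl, hp] at this
        omega
    · rw [if_neg hjl, h.p_iff j h0 hj]
      by_cases hi : i = R
      · simp [hi, Ne.symm hjl]
      · rw [if_neg hi]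
        exact and_congr_left fun _ => by omega
  · intro j hj _ hpj
    rw [hp', if_neg (by omega)] at hpj
    exact h.free j hj (by omega) hpj
  · rw [hp', if_neg (by omega), h.p_zero]

/-- With the virtual column empty, the conditions hold without exception, so any column may be
declared exempt. This starts each deletion from the saved solution. -/
theorem Good.change_deleted (h : Good k l R (l + 1) W y z p q) (hp : p (l + 1) = 0) (c : ℕ) :
    Good k l R c W y z p q := by
  have hq : ∀ i < R, q i ≠ l + 1 := fun i hi hq => by
    have := (h.p_iff (l + 1) (by omega) le_rfl i).2 ⟨hi, hq⟩
    omega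
  exact ⟨h.le_rows, h.feas, h.z_zero, h.z_nonneg, h.q_le, fun i hi _ => h.tight i hi (hq i hi),
    h.p_iff, fun j hj _ => h.free j hj (by omega), h.p_zero⟩

end Hungarian

/-! ### Weak duality and maximum weight matchings. -/

namespace Hungarian

variable {k l b : ℕ} {W : ℕ → ℕ → ℝ} {y z : ℕ → ℝ} {p q : ℕ → ℕ}

theorem Good.q_ne (h : Good k l k b W y z p q) (hb : b ≠ 0) (hbl : b ≤ l + 1) (hpb : p b = 0)
    {i : ℕ} (hi : i < k) : q i ≠ b := fun hq => by
  have := (h.p_iff b hb hbl i).2 ⟨hi, hq⟩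
  omega

/-- Weak duality. -/
theorem Good.sum_le (h : Good k l k b W y z p q) (hb : b ≠ 0) (hbl : b ≤ l + 1) (hpb : p b = 0)
    (hW : ∀ i < k, W i 0 = 0) (S : Finset (Fin k × Fin l))
    (h1 : ∀ e ∈ S, ∀ f ∈ S, e.1 = f.1 → e = f) (h2 : ∀ e ∈ S, ∀ f ∈ S, e.2 = f.2 → e = f)
    (hS : ∀ e ∈ S, (e.2 : ℕ) + 1 ≠ b) :
    ∑ e ∈ S, W e.1 (e.2 + 1) ≤ ∑ i : Fin k, W i (q i) := by
  -- Feasibility at the sink column, where `W` and `z` vanish.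
  have hy : ∀ i : Fin k, 0 ≤ y i := fun i => by
    have := h.feas i i.2 0 (Nat.zero_le _)
    rwa [hW i i.2, h.z_zero, add_zero] at this
  have hz : ∀ j : Fin l, 0 ≤ z (j + 1) := fun j => h.z_nonneg _ j.2
  have ht : ∀ i : Fin k, q i ≤ l ∧ W i (q i) = y i + z (q i) := fun i =>
    h.tight i i.2 (h.q_ne hb hbl hpb i.2)
  have e1 : ∑ e ∈ S, y e.1 ≤ ∑ i : Fin k, y i := by
    rw [← Finset.sum_image (s := S) (g := Prod.fst) (f := fun i : Fin k => y i)
      fun e he f hf => h1 e he f hf]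
    exact Finset.sum_le_sum_of_subset_of_nonneg (Finset.subset_univ _) fun i _ _ => hy i
  have e2 : ∑ e ∈ S, z (e.2 + 1) ≤ ∑ i : Fin k, z (q i) := by
    rw [← Finset.sum_image (s := S) (g := Prod.snd) (f := fun j : Fin l => z (j + 1))
      fun e he f hf => h2 e he f hf]
    -- Complementary slackness: unassigned columns contribute `0` since `S` avoids `b`, and assigned
    -- columns are charged to their distinct rows.
    rw [← Finset.sum_filter_add_sum_filter_not (S.image Prod.snd) (fun j : Fin l => p (j + 1) = 0),
      Finset.sum_eq_zero, zero_add]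
    · have hrow : ∀ j : Fin l, p (j + 1) ≠ 0 → ∃ i < k, q i = j + 1 := fun j hj => by
        obtain ⟨i, hi⟩ := Nat.exists_eq_succ_of_ne_zero hj
        exact ⟨i, (h.p_iff (j + 1) (by omega) (by omega) i).1 hi⟩
      choose! r hrk hr using hrow
      set A := (S.image Prod.snd).filter fun j : Fin l => ¬ p (j + 1) = 0
      have hA : ∀ j ∈ A, q (r j) = j + 1 := fun j hj => hr j (Finset.mem_filter.1 hj).2
      calc ∑ j ∈ A, z (j + 1) = ∑ j ∈ A, z (q (r j)) :=
            Finset.sum_congr rfl fun j hj => by rw [hA j hj]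
        _ = ∑ i ∈ A.image r, z (q i) := by
            rw [Finset.sum_image (f := fun i => z (q i))]
            intro j hj j' hj' he
            have := hA j hj
            rw [he, hA j' hj'] at this
            exact Fin.ext (by omega)
        _ ≤ ∑ i ∈ Finset.range k, z (q i) := by
            refine Finset.sum_le_sum_of_subset_of_nonneg ?_
              fun i hi _ => h.z_nonneg _ (ht ⟨i, Finset.mem_range.1 hi⟩).1
            intro i hi
            obtain ⟨j, hj, rfl⟩ := Finset.mem_image.1 hi
            exact Finset.mem_range.2 (hrk j (Finset.mem_filter.1 hj).2)
        _ = _ := Finset.sum_range _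
    · intro j hj
      obtain ⟨hj, hpj⟩ := Finset.mem_filter.1 hj
      obtain ⟨e, he, rfl⟩ := Finset.mem_image.1 hj
      exact h.free _ e.2.2 (hS e he) hpj
  calc ∑ e ∈ S, W e.1 (e.2 + 1) ≤ ∑ e ∈ S, (y e.1 + z (e.2 + 1)) :=
        Finset.sum_le_sum fun e _ => h.feas _ e.1.2 _ e.2.2
    _ = ∑ e ∈ S, y e.1 + ∑ e ∈ S, z (e.2 + 1) := Finset.sum_add_distrib
    _ ≤ ∑ i : Fin k, y i + ∑ i : Fin k, z (q i) := add_le_add e1 e2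
    _ = ∑ i : Fin k, W i (q i) := by
        rw [← Finset.sum_add_distrib]
        exact Finset.sum_congr rfl fun i _ => (ht i).2.symm

/-- The matrix `W` holds the positive parts of the weights of the edges in its columns
`1, …, l`. -/
structure IsWeightMatrix {k l : ℕ} (B : SimpleGraph (Fin k ⊕ Fin l))
    (w : Sym2 (Fin k ⊕ Fin l) → ℝ) (W : ℕ → ℕ → ℝ) : Prop where
  zero : ∀ i < k, W i 0 = 0
  adj : ∀ (i : Fin k) (j : Fin l), B.Adj (.inl i) (.inr j) →
    W i (j + 1) = max (w s(.inl i, .inr j)) 0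
  not_adj : ∀ (i : Fin k) (j : Fin l), ¬ B.Adj (.inl i) (.inr j) → W i (j + 1) = 0

variable {B : SimpleGraph (Fin k ⊕ Fin l)} {w : Sym2 (Fin k ⊕ Fin l) → ℝ}

theorem IsWeightMatrix.nonneg (hW : IsWeightMatrix B w W) (i : Fin k) (j : ℕ) (hj : j ≤ l) :
    0 ≤ W i j := by
  obtain _ | j := j
  · rw [hW.zero i i.2]
  · by_cases h : B.Adj (.inl i) (.inr ⟨j, hj⟩)
    · have := hW.adj i ⟨j, hj⟩ h
      simp only at this
      rw [this]
      exact le_max_right _ _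
    · have := hW.not_adj i ⟨j, hj⟩ h
      simp only at this
      rw [this]

theorem IsWeightMatrix.of_pos (hW : IsWeightMatrix B w W) (i : Fin k) (j : Fin l)
    (h : 0 < W i (j + 1)) : B.Adj (.inl i) (.inr j) ∧ W i (j + 1) = w s(.inl i, .inr j) := by
  by_cases ha : B.Adj (.inl i) (.inr j)
  · refine ⟨ha, ?_⟩
    have := hW.adj i j ha
    rcases le_total (w s(.inl i, .inr j)) 0 with h0 | h0
    · rw [max_eq_right h0] at this
      exact absurd h this.not_gt
    · rw [this, max_eq_left h0]
  · exact absurd h (hW.not_adj i j ha).not_gt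

theorem pair_inj {i i' : Fin k} {j j' : Fin l}
    (h : (s(.inl i, .inr j) : Sym2 (Fin k ⊕ Fin l)) = s(.inl i', .inr j')) : i = i' ∧ j = j' := by
  simpa using h

/-- The edges of positive weight of the assignment form a maximum weight matching of the graph
without the right vertex `b - 1`. -/
theorem Good.isMaxWeightMatching (h : Good k l k b W y z p q) (hb : b ≠ 0) (hbl : b ≤ l + 1)
    (hpb : p b = 0) (hW : IsWeightMatrix B w W)
    (hB : B ≤ completeBipartiteGraph (Fin k) (Fin l)) (H : B.Subgraph)
    (hH : ∀ i j, H.Adj (.inl i) (.inr j) ↔ B.Adj (.inl i) (.inr j) ∧ (j : ℕ) + 1 ≠ b)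
    (s : RealRAM.State) (r : ℕ)
    (hs : ∀ i < k, s.nat 2 (r * k + i) = if 0 < W i (q i) then q i else 0) :
    IsMaxWeightMatching H w (s.output k l r) := by
  have hcell : ∀ (i : Fin k) (j : Fin l),
      s.nat 2 (r * k + i) = j + 1 ↔ q i = j + 1 ∧ 0 < W i (q i) := by
    intro i j
    rw [hs i i.2]
    split_ifs with h0 <;> simp [h0]
  have hmem : ∀ e, e ∈ s.output k l r ↔ ∃ (i : Fin k) (j : Fin l), q i = j + 1 ∧ 0 < W i (q i) ∧
      e = s(.inl i, .inr j) := by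
    intro e
    simp only [RealRAM.State.output, Finset.mem_image, Finset.mem_filter, Finset.mem_univ, true_and,
      Prod.exists, hcell, and_assoc, eq_comm]
  have hedge : ∀ e ∈ H.edgeSet, ∃ (i : Fin k) (j : Fin l), e = s(.inl i, .inr j) := by
    intro e
    induction e using Sym2.ind with
    | _ u v =>
      intro he
      have := hB (H.adj_sub (SimpleGraph.Subgraph.mem_edgeSet.1 he))
      rcases u with u | u <;> rcases v with v | v <;> simp at this
      · exact ⟨u, v, rfl⟩
      · exact ⟨v, u, Sym2.eq_swap⟩
  have hsum : ∑ e ∈ s.output k l r, w e = ∑ i : Fin k, W i (q i) := by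
    rw [RealRAM.State.output, Finset.sum_image, Finset.sum_filter, Fintype.sum_prod_type]
    · refine Finset.sum_congr rfl fun i _ => ?_
      simp only [hcell]
      by_cases h0 : 0 < W i (q i)
      · have hq0 : q i ≠ 0 := fun hq => by rw [hq, hW.zero i i.2] at h0; exact lt_irrefl _ h0
        obtain ⟨j, hj⟩ := Nat.exists_eq_succ_of_ne_zero hq0
        have hql := (h.tight i i.2 (h.q_ne hb hbl hpb i.2)).1
        rw [Finset.sum_eq_single (⟨j, by omega⟩ : Fin l)]
        · rw [if_pos ⟨hj, h0⟩]
          rw [hj] at h0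
          rw [hj]
          exact (hW.of_pos i ⟨j, by omega⟩ h0).2.symm
        · intro j' _ hne
          rw [if_neg]
          rintro ⟨h3, -⟩
          exact hne (Fin.ext (by simp only; omega))
        · simp
      -- A row at the sink, or at an entry of weight `0`, stays uncovered; this loses nothing
      -- because `W` is nonnegative.
      · have hql := (h.tight i i.2 (h.q_ne hb hbl hpb i.2)).1
        have := hW.nonneg i _ hql
        rw [Finset.sum_eq_zero fun j _ => if_neg fun h' => h0 h'.2]
        exact le_antisymm this (not_lt.1 h0)
    · rintro ⟨i, j⟩ - ⟨i', j'⟩ - he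
      obtain ⟨rfl, rfl⟩ := pair_inj he
      rfl
  refine ⟨⟨?_, ?_⟩, ?_⟩
  · intro e he
    obtain ⟨i, j, hq, h0, rfl⟩ := (hmem e).1 he
    rw [SimpleGraph.Subgraph.mem_edgeSet, hH]
    rw [hq] at h0
    exact ⟨(hW.of_pos i j h0).1, hq ▸ h.q_ne hb hbl hpb i.2⟩
  · intro e he f hf x hxe hxf
    obtain ⟨i, j, hq, h0, rfl⟩ := (hmem e).1 he
    obtain ⟨i', j', hq', h0', rfl⟩ := (hmem f).1 hf
    rw [Sym2.mem_iff] at hxe hxf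
    have : i = i' ∨ j = j' := by
      rcases hxe with rfl | rfl <;> rcases hxf with hx | hx <;> simp at hx <;> simp [hx]
    rcases this with rfl | rfl
    · obtain rfl : j = j' := Fin.ext (by omega)
      rfl
    · obtain rfl : i = i' := Fin.ext (h.q_inj i.2 i'.2 (by omega) (by omega))
      rfl
  · intro M' hM'
    classical
    set S : Finset (Fin k × Fin l) := Finset.univ.filter fun e => s(.inl e.1, .inr e.2) ∈ M' with hS
    have hSmem : ∀ e, e ∈ S ↔ s(.inl e.1, .inr e.2) ∈ M' := by simp [hS]
    have hM : M' = S.image fun e => s(.inl e.1, .inr e.2) := by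
      ext e
      rw [Finset.mem_image]
      constructor
      · intro he
        obtain ⟨i, j, rfl⟩ := hedge e (hM'.1 e he)
        exact ⟨(i, j), (hSmem _).2 he, rfl⟩
      · rintro ⟨e, he, rfl⟩
        exact (hSmem _).1 he
    have hadj : ∀ e ∈ S, B.Adj (.inl e.1) (.inr e.2) ∧ (e.2 : ℕ) + 1 ≠ b := fun e he =>
      (hH _ _).1 (SimpleGraph.Subgraph.mem_edgeSet.1 (hM'.1 _ ((hSmem e).1 he)))
    calc ∑ e ∈ M', w e = ∑ e ∈ S, w s(.inl e.1, .inr e.2) := by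
          conv_lhs => rw [hM]
          rw [Finset.sum_image]
          rintro ⟨i, j⟩ - ⟨i', j'⟩ - he
          obtain ⟨rfl, rfl⟩ := pair_inj he
          rfl
      _ ≤ ∑ e ∈ S, W e.1 (e.2 + 1) := Finset.sum_le_sum fun e he => by
          rw [hW.adj _ _ (hadj e he).1]
          exact le_max_left _ _
      _ ≤ ∑ i : Fin k, W i (q i) := by
          refine h.sum_le hb hbl hpb hW.zero S ?_ ?_ fun e he => (hadj e he).2
          · rintro ⟨i, j⟩ he ⟨i', j'⟩ hf (rfl : i = i')
            have := hM'.2 _ ((hSmem _).1 he) _ ((hSmem _).1 hf) (.inl i) (by simp) (by simp)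
            exact Prod.ext rfl (pair_inj this).2
          · rintro ⟨i, j⟩ he ⟨i', j'⟩ hf (rfl : j = j')
            have := hM'.2 _ ((hSmem _).1 he) _ ((hSmem _).1 hf) (.inr j) (by simp) (by simp)
            exact Prod.ext (pair_inj this).1 rfl
      _ = _ := hsum.symm

end Hungarian

namespace RealRAM

open Hungarian

/-! ### The augmentation step

Arrays of naturals: `3` row offsets of the weight matrix, `4` row assigned to a column (plus one),
`5` column assigned to a row, `6` columns in the tree, `7` parents in the tree. Scalars: `10` and
`11` loop counters, `12` closest column, `13` newest row, `14` deleted column, `15` end of the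
augmenting path. Arrays of reals: `1` weight matrix, `2` and `3` dual variables, `4` slacks, `7`
least slack. -/

abbrev leftSize : NatExpr := .read 0 (.const 0)

abbrev rightSize : NatExpr := .read 0 (.const 1)

/-- The reduced cost of the edge from row `i` to column `j`. -/
abbrev reducedCost (i j : NatExpr) : RealExpr :=
  .sub (.add (.read 2 i) (.read 3 j)) (.read 1 (.add (.read 3 i) j))

abbrev initTree : Program :=
  forLoop 10 (.add rightSize (.const 2))
    (.seq (.natSet 6 (var 10) (.const 0))
      (.seq (.natSet 7 (var 10) (var 14))
        (.realSet 4 (var 10) (reducedCost (var 13) (var 10)))))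

/-- Started with `12` pointing to the sink, which is never in the tree and so is a valid first
candidate. -/
abbrev findClosest : Program :=
  forLoop 10 (.add rightSize (.const 1))
    (.branch (.conj (.natLt (.read 6 (var 10)) (.const 1))
        (.realLt (.read 4 (var 10)) (.read 4 (var 12))))
      (assign 12 (var 10)) .skip)

/-- Scans columns only: the tree rows are the rows assigned to tree columns, so the cost is `O(l)`
and not `O(k)`. The virtual column is included because it may be the root. -/
abbrev updateDuals : Program :=
  forLoop 10 (.add rightSize (.const 2))
    (.branch (.natLt (.const 0) (.read 6 (var 10)))
      (.seq (.realSet 2 (.sub (.read 4 (var 10)) (.const 1))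
          (.sub (.read 2 (.sub (.read 4 (var 10)) (.const 1))) (.read 7 (.const 0))))
        (.realSet 3 (var 10) (.add (.read 3 (var 10)) (.read 7 (.const 0)))))
      (.realSet 4 (var 10) (.sub (.read 4 (var 10)) (.read 7 (.const 0)))))

abbrev dualStep : Program :=
  .seq (assign 12 (.const 0)) (.seq findClosest
    (.seq (.realSet 7 (.const 0) (.read 4 (var 12))) updateDuals))

abbrev relax : Program :=
  forLoop 10 (.add rightSize (.const 1))
    (.branch (.conj (.natLt (.read 6 (var 10)) (.const 1))
        (.realLt (reducedCost (var 13) (var 10)) (.read 4 (var 10))))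
      (.seq (.realSet 4 (var 10) (reducedCost (var 13) (var 10))) (.natSet 7 (var 10) (var 12)))
      .skip)

abbrev growTree : Program :=
  .seq (.natSet 6 (var 12) (.const 1))
    (.seq (assign 13 (.sub (.read 4 (var 12)) (.const 1))) (.seq relax dualStep))

abbrev flipPath : Program :=
  .loop (.neg (.conj (.neg (.natLt (var 15) (var 14))) (.neg (.natLt (var 14) (var 15)))))
    (.seq (.natSet 4 (var 15) (.read 4 (.read 7 (var 15))))
      (.seq (.natSet 5 (.sub (.read 4 (.read 7 (var 15))) (.const 1)) (var 15))
        (assign 15 (.read 7 (var 15)))))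

abbrev augment : Program :=
  .seq (assign 15 (var 12)) (.seq flipPath
    (.seq (.natSet 4 (var 14) (.const 0)) (.natSet 4 (.const 0) (.const 0))))

/-- Deletes the column `14` and reassigns its row. -/
abbrev reassign : Program :=
  .seq (assign 13 (.sub (.read 4 (var 14)) (.const 1)))
    (.seq initTree (.seq (.natSet 6 (var 14) (.const 1)) (.seq dualStep
      (.seq (.loop (.natLt (.const 0) (.read 4 (var 12))) growTree) augment))))

/-- The memory contains the sizes and the weight matrix. -/
def HoldsMatrix (k l : ℕ) (W : ℕ → ℕ → ℝ) (s : State) : Prop :=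
  s.nat 0 0 = k ∧ s.nat 0 1 = l ∧ ∀ i < k, ∀ j ≤ l, s.real 1 (s.nat 3 i + j) = W i j

theorem HoldsMatrix.congr {k l : ℕ} {W : ℕ → ℕ → ℝ} {s s' : State} (h : HoldsMatrix k l W s)
    (h0 : s'.nat 0 = s.nat 0) (h3 : s'.nat 3 = s.nat 3) (h1 : s'.real 1 = s.real 1) :
    HoldsMatrix k l W s' := by
  unfold HoldsMatrix
  rw [h0, h3, h1]
  exact h

/-! ### Loops over the columns. -/

variable {k l R b n : ℕ} {W : ℕ → ℕ → ℝ} {s : State} {ρ : ℕ → ℕ}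

theorem runs_initTree (h : HoldsMatrix k l W s) (hi : s.nat 13 0 < k) :
    Runs initTree s ((l + 3) * 100) fun s' =>
      (∀ j ≤ l + 1, s'.nat 6 j = 0 ∧ s'.nat 7 j = s.nat 14 0) ∧
      ∀ j ≤ l, s'.real 4 j = s.real 2 (s.nat 13 0) + s.real 3 j - W (s.nat 13 0) j := by
  -- The invariant mentions raw cells instead of `W`, because the loop also visits column `l + 1`,
  -- which the weight matrix lacks; the slack written there is never used.
  refine (Runs.forLoop_const (l + 2) 80 (fun m s' => (∀ j < m, s'.nat 6 j = 0 ∧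
      s'.nat 7 j = s.nat 14 0) ∧ ∀ j < m, s'.real 4 j = s.real 2 (s.nat 13 0) + s.real 3 j -
      s.real 1 (s.nat 3 (s.nat 13 0) + j)) (by decide) ?_ ?_ ?_ fun s' h => h).mono ?_ ?_
  · intro s' hA
    simp [hA.1 0 (by decide), h.2.1]
  · simp
  · intro m s' hm hA hx hI
    refine Runs.of_exec (by decide) (by decide) ?_
    have e14 := hA.1 14 (by decide)
    have e13 := hA.1 13 (by decide)
    have e3 := hA.1 3 (by decide)
    have r1 := hA.2 1 (by decide)
    have r2 := hA.2 2 (by decide)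
    have r3 := hA.2 3 (by decide)
    simp [hx, e14, e13, e3, r1, r2, r3, Function.update_apply]
    refine ⟨fun j hj => ?_, fun j hj => ?_⟩
    · by_cases hjm : j = m
      · simp [hjm]
      · simpa [hjm] using hI.1 j (by omega)
    · by_cases hjm : j = m
      · simp [hjm]
      · simpa [hjm] using hI.2 j (by omega)
  · simp [NatExpr.cost]
  · intro s' _ hs'
    refine ⟨fun j hj => hs'.1 j (by omega), fun j hj => ?_⟩
    rw [hs'.2 j (by omega), h.2.2 _ hi j hj]

theorem runs_findClosest (h : s.nat 0 1 = l) (h0 : s.nat 6 0 = 0) (ht : s.nat 12 0 = 0) :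
    Runs findClosest s ((l + 3) * 100) fun s' =>
      s'.nat 12 0 ≤ l ∧ s.nat 6 (s'.nat 12 0) = 0 ∧
      ∀ j ≤ l, s.nat 6 j = 0 → s.real 4 (s'.nat 12 0) ≤ s.real 4 j := by
  refine (Runs.forLoop_const (l + 1) 80 (fun m s' => s'.nat 12 0 ≤ l ∧
    s.nat 6 (s'.nat 12 0) = 0 ∧ ∀ j < m, s.nat 6 j = 0 → s.real 4 (s'.nat 12 0) ≤ s.real 4 j)
    (by decide) ?_ ?_ ?_ fun s' h => h).mono ?_ ?_
  · intro s' hA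
    simp [hA.1 0 (by decide), h]
  · simp [ht, h0]
  · intro m s' hm hA hx hI
    refine Runs.of_exec (by decide) (by decide) ?_
    have e6 := hA.1 6 (by decide)
    have r4 := hA.2 4 (by decide)
    simp [hx, e6, r4]
    split_ifs with hc
    · simp
      refine ⟨by omega, hc.1, fun j hj hu => ?_⟩
      by_cases hjm : j = m
      · rw [hjm]
      · exact hc.2.le.trans (hI.2.2 j (by omega) hu)
    · refine ⟨hI.1, hI.2.1, fun j hj hu => ?_⟩
      by_cases hjm : j = m
      · subst hjm
        exact not_lt.1 fun h' => hc ⟨hu, h'⟩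
      · exact hI.2.2 j (by omega) hu
  · simp [NatExpr.cost]; omega
  · intro s' _ hs'
    exact ⟨hs'.1, hs'.2.1, fun j hj => hs'.2.2 j (by omega)⟩

theorem runs_updateDuals (h : s.nat 0 1 = l)
    (hp : ∀ j, j ≠ 0 → j ≤ l + 1 → ∀ i, s.nat 4 j = i + 1 ↔ i < R ∧ s.nat 5 i = j)
    (hq : ∀ i < R, s.nat 5 i ≤ l + 1)
    (hu : ∀ j ≤ l + 1, 0 < s.nat 6 j → j ≠ 0 ∧ ∃ i < R, s.nat 5 i = j) :
    Runs updateDuals s ((l + 3) * 100) fun s' =>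
      (∀ i, s'.real 2 i = if i < R ∧ 0 < s.nat 6 (s.nat 5 i) then s.real 2 i - s.real 7 0
        else s.real 2 i) ∧
      (∀ j ≤ l + 1, s'.real 3 j = if 0 < s.nat 6 j then s.real 3 j + s.real 7 0 else s.real 3 j) ∧
      ∀ j ≤ l, s.nat 6 j = 0 → s'.real 4 j = s.real 4 j - s.real 7 0 := by
  -- A tree row `i` is updated exactly when the counter passes its column `s.nat 5 i`.
  refine (Runs.forLoop_const (l + 2) 80 (fun m s' =>
      (∀ i, s'.real 2 i = if i < R ∧ 0 < s.nat 6 (s.nat 5 i) ∧ s.nat 5 i < m then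
        s.real 2 i - s.real 7 0 else s.real 2 i) ∧
      (∀ j, s'.real 3 j = if 0 < s.nat 6 j ∧ j < m then s.real 3 j + s.real 7 0
        else s.real 3 j) ∧
      ∀ j, s'.real 4 j = if s.nat 6 j = 0 ∧ j < m then s.real 4 j - s.real 7 0 else s.real 4 j)
    (by decide) ?_ ?_ ?_ fun s' h => h).mono ?_ ?_
  · intro s' hA
    simp [hA.1 0 (by decide), h]
  · simp
  · intro m s' hm hA hx hI
    refine Runs.of_exec (by decide) (by decide) ?_
    have e6 := hA.1 6 (by decide)
    have e4 := hA.1 4 (by decide)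
    have r7 := hA.2 7 (by decide)
    obtain ⟨I1, I2, I3⟩ := hI
    simp only [Program.exec, Test.Holds, NatExpr.eval, hx, e6]
    split_ifs with hc
    · obtain ⟨h0, i₀, hi₀, hq₀⟩ := hu m (by omega) hc
      have hpm := (hp m h0 (by omega) i₀).2 ⟨hi₀, hq₀⟩
      simp [hx, e4, r7, hpm, Function.update_apply]
      refine ⟨fun i => ?_, fun j => ?_, fun j => ?_⟩
      · by_cases hi : i = i₀
        · subst hi
          rw [if_pos rfl, if_pos ⟨hi₀, by rw [hq₀]; exact hc, by omega⟩, I1, if_neg (by omega)]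
        · rw [if_neg hi, I1]
          refine if_congr (and_congr_right fun h1 => and_congr_right fun h2 => ?_) rfl rfl
          have : s.nat 5 i ≠ m := fun h' => by
            have := (hp m h0 (by omega) i).2 ⟨h1, h'⟩
            omega
          omega
      · by_cases hj : j = m
        · subst hj
          rw [if_pos rfl, if_pos ⟨hc, by omega⟩, I2, if_neg (by omega)]
        · rw [if_neg hj, I2]
          exact if_congr (and_congr_right fun h1 => by omega) rfl rfl
      · rw [I3]
        exact if_congr (and_congr_right fun h1 => by
          have : j ≠ m := by rintro rfl; omega
          omega) rfl rfl
    · simp [hx, r7, Function.update_apply]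
      refine ⟨fun i => ?_, fun j => ?_, fun j => ?_⟩
      · rw [I1]
        refine if_congr (and_congr_right fun h1 => and_congr_right fun h2 => ?_) rfl rfl
        have : s.nat 5 i ≠ m := fun h' => hc (h' ▸ h2)
        omega
      · rw [I2]
        exact if_congr (and_congr_right fun h1 => by
          have : j ≠ m := by rintro rfl; omega
          omega) rfl rfl
      · by_cases hj : j = m
        · subst hj
          rw [if_pos rfl, if_pos ⟨by omega, by omega⟩, I3, if_neg (by omega)]
        · rw [if_neg hj, I3]
          exact if_congr (and_congr_right fun h1 => by omega) rfl rfl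
  · simp [NatExpr.cost]
  · rintro s' - ⟨I1, I2, I3⟩
    refine ⟨fun i => ?_, fun j hj => ?_, fun j hj hu => ?_⟩
    · rw [I1]
      exact if_congr (and_congr_right fun h1 => by have := hq i h1; omega) rfl rfl
    · rw [I2]
      exact if_congr (by omega) rfl rfl
    · rw [I3, if_pos ⟨hu, by omega⟩]

theorem runs_relax (h : HoldsMatrix k l W s) (hi : s.nat 13 0 < k) :
    Runs relax s ((l + 3) * 100) fun s' =>
      (∀ j, 0 < s.nat 6 j → s'.nat 7 j = s.nat 7 j) ∧
      ∀ j ≤ l, s.nat 6 j = 0 →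
        (s'.real 4 j = s.real 4 j ∧ s'.nat 7 j = s.nat 7 j ∧
          s.real 4 j ≤ s.real 2 (s.nat 13 0) + s.real 3 j - W (s.nat 13 0) j) ∨
        (s'.real 4 j = s.real 2 (s.nat 13 0) + s.real 3 j - W (s.nat 13 0) j ∧
          s'.nat 7 j = s.nat 12 0 ∧
          s.real 2 (s.nat 13 0) + s.real 3 j - W (s.nat 13 0) j ≤ s.real 4 j) := by
  refine (Runs.forLoop_const (l + 1) 80 (fun m s' =>
      (∀ j, 0 < s.nat 6 j → s'.nat 7 j = s.nat 7 j) ∧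
      (∀ j, m ≤ j → s'.real 4 j = s.real 4 j ∧ s'.nat 7 j = s.nat 7 j) ∧
      ∀ j < m, s.nat 6 j = 0 →
        (s'.real 4 j = s.real 4 j ∧ s'.nat 7 j = s.nat 7 j ∧
          s.real 4 j ≤ s.real 2 (s.nat 13 0) + s.real 3 j - W (s.nat 13 0) j) ∨
        (s'.real 4 j = s.real 2 (s.nat 13 0) + s.real 3 j - W (s.nat 13 0) j ∧
          s'.nat 7 j = s.nat 12 0 ∧
          s.real 2 (s.nat 13 0) + s.real 3 j - W (s.nat 13 0) j ≤ s.real 4 j))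
    (by decide) ?_ ?_ ?_ fun s' h => h).mono ?_ ?_
  · intro s' hA
    simp [hA.1 0 (by decide), h.2.1]
  · simp
  · intro m s' hm hA hx hI
    refine Runs.of_exec (by decide) (by decide) ?_
    have e6 := hA.1 6 (by decide)
    have e13 := hA.1 13 (by decide)
    have e12 := hA.1 12 (by decide)
    have e3 := hA.1 3 (by decide)
    have r1 := hA.2 1 (by decide)
    have r2 := hA.2 2 (by decide)
    have r3 := hA.2 3 (by decide)
    have hW := h.2.2 _ hi m (by omega)
    obtain ⟨I1, I2, I3⟩ := hI
    have I2m := I2 m le_rfl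
    simp [hx, e6, e13, e3, r1, r2, r3, hW, I2m.1, -tsub_le_iff_right]
    split_ifs with hc
    · simp only [State.setNat_nat_self, State.setReal_real_self, State.setNat_real,
        State.setReal_nat, e12, Function.update_apply]
      refine ⟨fun j hj => ?_, fun j hj => ?_, fun j hj hu => ?_⟩
      · rw [if_neg (by rintro rfl; omega), I1 j hj]
      · rw [if_neg (by omega), if_neg (by omega)]
        exact I2 j (by omega)
      · by_cases hjm : j = m
        · subst hjm
          simp only [if_true]
          exact .inr ⟨trivial, trivial, hc.2.le⟩
        · rw [if_neg hjm, if_neg hjm]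
          exact I3 j (by omega) hu
    · refine ⟨I1, fun j hj => I2 j (by omega), fun j hj hu => ?_⟩
      by_cases hjm : j = m
      · subst hjm
        have : ¬ _ := fun h' => hc ⟨hu, h'⟩
        exact .inl ⟨I2m.1, I2m.2, by linarith⟩
      · simpa using I3 j (by omega) hu
  · simp [NatExpr.cost]; omega
  · rintro s' - ⟨I1, -, I3⟩
    exact ⟨I1, fun j hj => I3 j (by omega)⟩

end RealRAM

/-! ### One complete search. -/

namespace RealRAM

open Hungarian

variable {k l R b n : ℕ} {W : ℕ → ℕ → ℝ} {s : State} {ρ : ℕ → ℕ}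

/-- The memory contains optimal duals and an optimal assignment, up to column `b`. -/
def HoldsGood (k l R b : ℕ) (W : ℕ → ℕ → ℝ) (s : State) : Prop :=
  Good k l R b W (s.real 2) (s.real 3) (s.nat 4) (s.nat 5)

/-- The memory contains an alternating tree. -/
def HoldsTree (k l R b n : ℕ) (W : ℕ → ℕ → ℝ) (ρ : ℕ → ℕ) (s : State) : Prop :=
  HoldsGood k l R b W s ∧
    Tree l R b n W (s.real 2) (s.real 3) (s.real 4) (s.nat 5) (s.nat 6) (s.nat 7) ρ

/-- The column that the variable `12` points to can be added to the tree. -/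
def ClosestTight (l : ℕ) (s : State) : Prop :=
  s.nat 12 0 ≤ l ∧ s.nat 6 (s.nat 12 0) = 0 ∧ s.real 4 (s.nat 12 0) = 0

theorem runs_dualStep (h : s.nat 0 1 = l) (hs : HoldsTree k l R b n W ρ s) :
    Runs dualStep s ((l + 3) * 300) fun s' =>
      HoldsTree k l R b n W ρ s' ∧ ClosestTight l s' := by
  obtain ⟨hg, ht⟩ := hs
  refine Runs.mono (T := 10 + ((l + 3) * 100 + (10 + (l + 3) * 100))) ?_ (by omega) fun _ _ h => h
  refine Runs.seq (Q := fun s₁ => s₁ = s.setNat 12 0 0)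
    (Runs.of_exec (by decide) (by decide) (by simp)) ?_
  rintro s₁ - rfl
  have h0 : s.nat 6 0 = 0 := by
    by_contra h0
    exact (ht.row 0 (by omega) (by omega)).1 rfl
  refine Runs.seq (runs_findClosest (l := l) (by simpa) (by simpa) (by simp)) ?_
  intro s₂ hA hs₂
  simp at hs₂
  have e0 : s₂.nat 0 = s.nat 0 := by rw [hA.1 0 (by decide)]; simp
  have e4 : s₂.nat 4 = s.nat 4 := by rw [hA.1 4 (by decide)]; simp
  have e5 : s₂.nat 5 = s.nat 5 := by rw [hA.1 5 (by decide)]; simp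
  have e6 : s₂.nat 6 = s.nat 6 := by rw [hA.1 6 (by decide)]; simp
  have e7 : s₂.nat 7 = s.nat 7 := by rw [hA.1 7 (by decide)]; simp
  have r2 : s₂.real 2 = s.real 2 := by rw [hA.2 2 (by decide)]; simp
  have r3 : s₂.real 3 = s.real 3 := by rw [hA.2 3 (by decide)]; simp
  have r4 : s₂.real 4 = s.real 4 := by rw [hA.2 4 (by decide)]; simp
  refine Runs.seq (Q := fun s₃ => s₃ = s₂.setReal 7 0 (s.real 4 (s₂.nat 12 0)))
    (Runs.of_exec (by decide) (by decide) (by simp [r4])) ?_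
  rintro s₃ - rfl
  refine (runs_updateDuals (l := l) (R := R) (by simpa [e0]) (by simpa [e4, e5] using hg.p_iff)
    (by simpa [e5] using hg.q_le)
    (by simpa [e5, e6] using fun j hj hu => ⟨(ht.row j hj hu).1, (ht.row j hj hu).2.2⟩)).mono
    le_rfl ?_
  intro s₄ hA hs₄
  simp [e5, e6, r2, r3, r4] at hs₄
  have f4 : s₄.nat 4 = s.nat 4 := by rw [hA.1 4 (by decide)]; simp [e4]
  have f5 : s₄.nat 5 = s.nat 5 := by rw [hA.1 5 (by decide)]; simp [e5]
  have f6 : s₄.nat 6 = s.nat 6 := by rw [hA.1 6 (by decide)]; simp [e6]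
  have f7 : s₄.nat 7 = s.nat 7 := by rw [hA.1 7 (by decide)]; simp [e7]
  have f12 : s₄.nat 12 = s₂.nat 12 := by rw [hA.1 12 (by decide)]; simp
  obtain ⟨g1, g2, g3⟩ := Tree.update hg ht hs₂.1 hs₂.2.1 hs₂.2.2 (fun i _ => hs₄.1 i)
    hs₄.2.1 hs₄.2.2
  unfold HoldsTree HoldsGood ClosestTight
  rw [f4, f5, f6, f7, f12]
  exact ⟨⟨g1, g2⟩, hs₂.1, hs₂.2.1, g3⟩

theorem runs_growTree (h : HoldsMatrix k l W s) (hs : HoldsTree k l R b n W ρ s)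
    (hc : ClosestTight l s) (hp : 0 < s.nat 4 (s.nat 12 0)) :
    Runs growTree s ((l + 3) * 420) fun s' =>
      HoldsTree k l R b (n + 1) W (Function.update ρ (s.nat 12 0) n) s' ∧ ClosestTight l s' := by
  obtain ⟨hg, ht⟩ := hs
  obtain ⟨i₀, hi₀⟩ := Nat.exists_eq_succ_of_ne_zero hp.ne'
  have ht0 : s.nat 12 0 ≠ 0 := fun h0 => by rw [h0, hg.p_zero] at hp; omega
  have hi : i₀ < k := (((hg.p_iff _ ht0 (by have := hc.1; omega) i₀).1 hi₀).1).trans_le hg.le_rows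
  refine Runs.mono (T := 10 + (10 + ((l + 3) * 100 + (l + 3) * 300))) ?_ (by omega)
    fun _ _ h => h
  refine Runs.seq (Q := fun s₁ => s₁ = s.setNat 6 (s.nat 12 0) 1)
    (Runs.of_exec (by decide) (by decide) (by simp)) ?_
  rintro s₁ - rfl
  refine Runs.seq (Q := fun s₁ => s₁ = (s.setNat 6 (s.nat 12 0) 1).setNat 13 0 i₀)
    (Runs.of_exec (by decide) (by decide) (by simp [hi₀])) ?_
  rintro s₁ - rfl
  refine Runs.seq (runs_relax (k := k) (l := l) (W := W) (h.congr (by simp) (by simp) (by simp))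
    (by simpa)) ?_
  intro s₂ hA hs₂
  simp only [State.setNat_nat_self, State.setNat_real, ne_eq, Nat.reduceEqDiff, not_false_eq_true,
    State.setNat_nat_of_ne, Function.update_self] at hs₂
  have e0 : s₂.nat 0 = s.nat 0 := by rw [hA.1 0 (by decide)]; simp
  have e4 : s₂.nat 4 = s.nat 4 := by rw [hA.1 4 (by decide)]; simp
  have e5 : s₂.nat 5 = s.nat 5 := by rw [hA.1 5 (by decide)]; simp
  have e6 : s₂.nat 6 = Function.update (s.nat 6) (s.nat 12 0) 1 := by
    rw [hA.1 6 (by decide)]; simp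
  have r2 : s₂.real 2 = s.real 2 := by rw [hA.2 2 (by decide)]; simp
  have r3 : s₂.real 3 = s.real 3 := by rw [hA.2 3 (by decide)]; simp
  refine runs_dualStep (by rw [e0]; exact h.2.1) ?_
  unfold HoldsTree HoldsGood
  rw [e4, e5, e6, r2, r3]
  exact ⟨hg, ht.grow hg hc.1 hc.2.1 hc.2.2 hi₀ (fun _ => rfl) (fun j _ hj => hs₂.1 j hj) hs₂.2⟩

/-- The insertion time `ρ` of the hole is the variant. It is a ghost variable: the program does not
store it. -/
theorem runs_flipPath {b : ℕ} (hb : s.nat 14 0 = b) (hn : ρ (s.nat 15 0) ≤ n)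
    (hs : Augmenting l R b (s.nat 15 0) W (s.real 2) (s.real 3) (s.nat 4) (s.nat 5) (s.nat 6)
      (s.nat 7) ρ) :
    Runs flipPath s ((n + 1) * 100) fun s' =>
      Augmenting l R b b W (s.real 2) (s.real 3) (s'.nat 4) (s'.nat 5) (s.nat 6) (s.nat 7) ρ := by
  refine (Runs.loop (fun s' => Augmenting l R b (s'.nat 15 0) W (s.real 2) (s.real 3) (s'.nat 4)
    (s'.nat 5) (s.nat 6) (s.nat 7) ρ) (fun s' => ρ (s'.nat 15 0)) 60 n hs hn ?_).mono ?_ ?_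
  · intro s' hA hI hc
    refine Runs.of_exec (by decide) (by decide) ?_
    have e7 := hA.1 7 (by decide)
    have e14 := hA.1 14 (by decide)
    simp [e14, hb] at hc
    obtain ⟨h1, h2⟩ := hI.step (by omega)
    have hw : s.nat 7 (s'.nat 15 0) ≠ s'.nat 15 0 := fun h => by rw [h] at h1; omega
    simp [e7, hw]
    exact ⟨h2, h1⟩
  · exact Nat.mul_le_mul_left _ (by decide)
  · rintro s' hA ⟨hI, hc⟩
    have e14 := hA.1 14 (by decide)
    simp [e14, hb] at hc
    rwa [show s'.nat 15 0 = b by omega] at hI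

theorem runs_augment (hb : s.nat 14 0 = b) (hb0 : b ≠ 0) (hs : HoldsTree k l R b n W ρ s)
    (hc : ClosestTight l s) (hp : s.nat 4 (s.nat 12 0) = 0) :
    Runs augment s ((l + 3) * 110) fun s' =>
      HoldsGood k l R b W s' ∧ s'.nat 4 b = 0 := by
  have hn := hs.2.size_le.2
  refine Runs.mono (T := 10 + ((n + 1) * 100 + (10 + 10))) ?_ (by omega) fun _ _ h => h
  refine Runs.seq (Q := fun s₁ => s₁ = s.setNat 15 0 (s.nat 12 0))
    (Runs.of_exec (by decide) (by decide) (by simp)) ?_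
  rintro s₁ - rfl
  refine Runs.seq (runs_flipPath (l := l) (R := R) (W := W) (b := b)
    (ρ := Function.update ρ (s.nat 12 0) n) (by simpa) (by simp)
    (by simpa using hs.2.augmenting hs.1 hc.1 hc.2.1 hc.2.2 hp)) ?_
  intro s₂ hA hs₂
  have e14 : s₂.nat 14 = s.nat 14 := by rw [hA.1 14 (by decide)]; simp
  have r2 : s₂.real 2 = s.real 2 := by rw [hA.2 2 (by decide)]; simp
  have r3 : s₂.real 3 = s.real 3 := by rw [hA.2 3 (by decide)]; simp
  simp only [State.setNat_real] at hs₂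
  refine Runs.mono (T := 20) (Runs.of_exec (by decide) (by decide)
    (Q := fun s' => HoldsGood k l R b W s' ∧ s'.nat 4 b = 0) ?_) (by omega) fun _ _ h => h
  simp [HoldsGood, r2, r3, e14, hb, hb0]
  refine hs₂.good hs.1 hb0 fun j => ?_
  simp only [Function.update_apply]
  by_cases h0 : j = 0 <;> by_cases hj : j = b <;> simp [h0, hj]

theorem runs_reassign (h : HoldsMatrix k l W s) (hg : HoldsGood k l R b W s)
    (hb : s.nat 14 0 = b) (hb0 : b ≠ 0) (hbl : b ≤ l + 1) (hp : s.nat 4 b ≠ 0) :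
    Runs reassign s ((l + 3) * ((min k (l + 1) + 1) * 1000)) fun s' =>
      HoldsGood k l R b W s' ∧ s'.nat 4 b = 0 := by
  obtain ⟨i₀, hi₀⟩ := Nat.exists_eq_succ_of_ne_zero hp
  have hi : i₀ < k := (((hg.p_iff _ hb0 hbl i₀).1 hi₀).1).trans_le hg.le_rows
  refine Runs.mono (T := 10 + ((l + 3) * 100 + (10 + ((l + 3) * 300 +
    ((min k (l + 1) + 1) * (5 + (l + 3) * 420 + 1) + (l + 3) * 110))))) ?_ ?_ fun _ _ h => h
  swap
  · set m := min k (l + 1) + 1 with hm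
    have h1 : 1 ≤ m := by omega
    have h2 : l + 3 ≤ (l + 3) * m := Nat.le_mul_of_pos_right _ h1
    have h3 : m * 3 ≤ (l + 3) * m := by nlinarith
    have h4 : m * (5 + (l + 3) * 420 + 1) = 420 * ((l + 3) * m) + 6 * m := by ring
    have h5 : (l + 3) * (m * 1000) = 1000 * ((l + 3) * m) := by ring
    rw [h4, h5]
    omega
  refine Runs.seq (Q := fun s₁ => s₁ = s.setNat 13 0 i₀)
    (Runs.of_exec (by decide) (by decide) (by simp [hb, hi₀])) ?_
  rintro s₁ - rfl
  refine Runs.seq (runs_initTree (k := k) (l := l) (W := W)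
    (h.congr (by simp) (by simp) (by simp)) (by simpa)) ?_
  intro s₂ hA hs₂
  have e0 : s₂.nat 0 = s.nat 0 := by rw [hA.1 0 (by decide)]; simp
  have e3 : s₂.nat 3 = s.nat 3 := by rw [hA.1 3 (by decide)]; simp
  have e4 : s₂.nat 4 = s.nat 4 := by rw [hA.1 4 (by decide)]; simp
  have e5 : s₂.nat 5 = s.nat 5 := by rw [hA.1 5 (by decide)]; simp
  have e14 : s₂.nat 14 = s.nat 14 := by rw [hA.1 14 (by decide)]; simp
  have r1 : s₂.real 1 = s.real 1 := by rw [hA.2 1 (by decide)]; simp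
  have r2 : s₂.real 2 = s.real 2 := by rw [hA.2 2 (by decide)]; simp
  have r3 : s₂.real 3 = s.real 3 := by rw [hA.2 3 (by decide)]; simp
  simp only [State.setNat_nat_self, State.setNat_real, ne_eq, Nat.reduceEqDiff, not_false_eq_true,
    State.setNat_nat_of_ne, Function.update_self, hb] at hs₂
  refine Runs.seq (Q := fun s₃ => s₃ = s₂.setNat 6 b 1)
    (Runs.of_exec (by decide) (by decide) (by simp [e14, hb])) ?_
  rintro s₃ - rfl
  have hM : HoldsMatrix k l W (s₂.setNat 6 b 1) :=
    h.congr (by simpa) (by simpa) (by simpa)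
  have htree : HoldsTree k l R b 1 W (fun _ => 0) (s₂.setNat 6 b 1) := by
    have hg' : HoldsGood k l R b W (s₂.setNat 6 b 1) := by
      simpa [HoldsGood, e4, e5, r2, r3] using hg
    refine ⟨hg', Tree.init hg' hb0 hbl (i := i₀) (by simpa [e4]) (fun j hj => ?_) (fun j hj => ?_)
      fun j hj => ?_⟩
    · simp only [State.setNat_nat_self, Function.update_apply, (hs₂.1 j hj).1]
    · simpa using (hs₂.1 j (by omega)).2
    · simpa [r2, r3] using hs₂.2 j hj
  refine Runs.seq (runs_dualStep hM.2.1 htree) ?_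
  intro s₄ hA₄ hs₄
  have hM₄ : HoldsMatrix k l W s₄ :=
    hM.congr (hA₄.1 0 (by decide)) (hA₄.1 3 (by decide)) (hA₄.2 1 (by decide))
  have hb₄ : s₄.nat 14 0 = b := by rw [hA₄.1 14 (by decide)]; simp [e14, hb]
  -- The size and order of the tree are existentially quantified; the size is recovered from the
  -- marks in array `6`, and its distance to `min R (l + 1)` is the variant.
  refine Runs.seq (Runs.loop
    (fun s' => ∃ n ρ, HoldsTree k l R b n W ρ s' ∧ ClosestTight l s')
    (fun s' => min R (l + 1) - ((Finset.range (l + 2)).filter fun j => 0 < s'.nat 6 j).card)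
    ((l + 3) * 420) (min k (l + 1)) ⟨1, _, hs₄⟩ ?_ ?_) ?_
  · have := hg.le_rows
    omega
  · rintro s₅ hA₅ ⟨n, ρ, ht, hc⟩ hh
    simp at hh
    have hM₅ : HoldsMatrix k l W s₅ :=
      hM₄.congr (hA₅.1 0 (by decide)) (hA₅.1 3 (by decide)) (hA₅.2 1 (by decide))
    refine (runs_growTree hM₅ ht hc hh).mono le_rfl ?_
    rintro s₆ - h₆
    refine ⟨⟨_, _, h₆⟩, ?_⟩
    have h7 := ht.2.card
    have h8 := h₆.1.2.card
    have h9 := h₆.1.2.size_le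
    omega
  · rintro s₅ hA₅ ⟨⟨n, ρ, ht, hc⟩, hh⟩
    simp at hh
    exact runs_augment (by rw [hA₅.1 14 (by decide), hb₄]) hb0 ht hc hh

end RealRAM

namespace RealRAM

open Hungarian

/-! ### The whole algorithm

Further arrays of naturals: `8`, `9` copies of `4`, `5`. Scalars: `16` offset of a row of the input,
`17` offset of a row of the weight matrix or of the output. Arrays of reals: `5`, `6` copies of
`2`, `3`. -/

/-- Computes a row of the weight matrix and a feasible dual variable. -/
abbrev readRow : Program :=
  forLoop 10 rightSize
    (.seq (.branch (.conj (.natLt (.const 0) (.read 1 (.add (var 16) (var 10))))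
        (.realLt .zero (.read 0 (.add (var 16) (var 10)))))
      (.realSet 1 (.add (var 17) (.add (var 10) (.const 1))) (.read 0 (.add (var 16) (var 10))))
      (.realSet 1 (.add (var 17) (.add (var 10) (.const 1))) .zero))
    (.realSet 2 (var 11) (.add (.read 2 (var 11))
      (.read 1 (.add (var 17) (.add (var 10) (.const 1)))))))

/-- Without multiplication, row offsets are accumulated by addition. There are two of them, since
input rows have `l` cells and rows of the weight matrix, with the sink in front, have `l + 1`. -/
abbrev readInput : Program :=
  .seq (assign 16 (.const 0)) (.seq (assign 17 (.const 0)) (forLoop 11 leftSize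
    (.seq (.natSet 3 (var 11) (var 17)) (.seq (.realSet 2 (var 11) .zero)
      (.seq (.realSet 1 (var 17) .zero) (.seq readRow
        (.seq (assign 16 (.add (var 16) rightSize))
          (assign 17 (.add (var 17) (.add rightSize (.const 1)))))))))))

abbrev clearColumns : Program :=
  forLoop 10 (.add rightSize (.const 2))
    (.seq (.natSet 4 (var 10) (.const 0)) (.realSet 3 (var 10) .zero))

abbrev insertRows : Program :=
  forLoop 11 leftSize
    (.seq (.seq (.natSet 4 (.add rightSize (.const 1)) (.add (var 11) (.const 1)))
      (.seq (.natSet 5 (var 11) (.add rightSize (.const 1)))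
        (assign 14 (.add rightSize (.const 1))))) reassign)

abbrev saveRows : Program :=
  forLoop 10 leftSize
    (.seq (.natSet 9 (var 10) (.read 5 (var 10))) (.realSet 5 (var 10) (.read 2 (var 10))))

abbrev saveColumns : Program :=
  forLoop 10 (.add rightSize (.const 2))
    (.seq (.natSet 8 (var 10) (.read 4 (var 10))) (.realSet 6 (var 10) (.read 3 (var 10))))

abbrev restoreRows : Program :=
  forLoop 10 leftSize
    (.seq (.natSet 5 (var 10) (.read 9 (var 10))) (.realSet 2 (var 10) (.read 5 (var 10))))

abbrev restoreColumns : Program :=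
  forLoop 10 (.add rightSize (.const 2))
    (.seq (.natSet 4 (var 10) (.read 8 (var 10))) (.realSet 3 (var 10) (.read 6 (var 10))))

abbrev writeMatching : Program :=
  forLoop 10 leftSize
    (.branch (.realLt .zero (.read 1 (.add (.read 3 (var 10)) (.read 5 (var 10)))))
      (.natSet 2 (.add (var 17) (var 10)) (.read 5 (var 10)))
      (.natSet 2 (.add (var 17) (var 10)) (.const 0)))

/-- Iteration `0` concerns the sink, which is never marked as assigned, and therefore outputs the
matching of `B` itself. -/
abbrev deleteColumns : Program :=
  forLoop 11 (.add rightSize (.const 1))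
    (.seq restoreRows
      (.seq (.branch (.natLt (.const 0) (.read 8 (var 11)))
          (.seq restoreColumns (.seq (assign 14 (var 11)) reassign)) .skip)
        (.seq writeMatching (assign 17 (.add (var 17) leftSize)))))

abbrev allMatchings : Program :=
  .seq readInput (.seq clearColumns (.seq insertRows (.seq saveRows (.seq saveColumns
    (.seq (assign 17 (.const 0)) deleteColumns)))))

/-! ### Reading the input and inserting the rows. -/

variable {k l R b n : ℕ} {W : ℕ → ℕ → ℝ} {s : State}

/-- The positive part of the weight in cell `c` of the input. -/
noncomputable def inputWeight (s : State) (c : ℕ) : ℝ :=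
  open Classical in if 0 < s.nat 1 c ∧ 0 < s.real 0 c then s.real 0 c else 0

theorem inputWeight_nonneg (s : State) (c : ℕ) : 0 ≤ inputWeight s c := by
  unfold inputWeight
  split_ifs with h
  exacts [h.2.le, le_rfl]

/-- The weight matrix of the input. -/
noncomputable def inputMatrix (l : ℕ) (s : State) (i j : ℕ) : ℝ :=
  if j = 0 then 0 else inputWeight s (i * l + (j - 1))

theorem HoldsInput.isWeightMatrix {B : SimpleGraph (Fin k ⊕ Fin l)}
    {w : Sym2 (Fin k ⊕ Fin l) → ℝ} (h : HoldsInput B w s) :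
    IsWeightMatrix B w (inputMatrix l s) := by
  obtain ⟨-, -, h1, h2⟩ := h
  refine ⟨fun i _ => rfl, fun i j ha => ?_, fun i j ha => ?_⟩
  · have h3 := h1 i j
    rw [if_pos ha] at h3
    simp only [inputMatrix, Nat.add_one_ne_zero, if_false, Nat.add_sub_cancel, inputWeight, h3,
      h2 i j ha]
    by_cases hw : 0 < w s(.inl i, .inr j)
    · rw [if_pos ⟨Nat.one_pos, hw⟩, max_eq_left hw.le]
    · rw [if_neg (fun h => hw h.2), max_eq_right (not_lt.1 hw)]
  · have h3 := h1 i j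
    rw [if_neg ha] at h3
    simp [inputMatrix, inputWeight, h3]

/-- The row dual accumulates the sum of the nonnegative weights of its row, which dominates each of
them and is therefore feasible with `z = 0`. -/
theorem runs_readRow (h : s.nat 0 1 = l) :
    Runs readRow s ((l + 1) * 100) fun s' =>
      (∀ c ≤ s.nat 17 0, s'.real 1 c = s.real 1 c) ∧
      (∀ j < l, s'.real 1 (s.nat 17 0 + (j + 1)) = inputWeight s (s.nat 16 0 + j)) ∧
      (∀ i, i ≠ s.nat 11 0 → s'.real 2 i = s.real 2 i) ∧
      s.real 2 (s.nat 11 0) ≤ s'.real 2 (s.nat 11 0) ∧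
      ∀ j < l, s.real 2 (s.nat 11 0) + inputWeight s (s.nat 16 0 + j) ≤
        s'.real 2 (s.nat 11 0) := by
  refine (Runs.forLoop_const l 80 (fun m s' =>
      (∀ c ≤ s.nat 17 0, s'.real 1 c = s.real 1 c) ∧
      (∀ j < m, s'.real 1 (s.nat 17 0 + (j + 1)) = inputWeight s (s.nat 16 0 + j)) ∧
      (∀ i, i ≠ s.nat 11 0 → s'.real 2 i = s.real 2 i) ∧
      s.real 2 (s.nat 11 0) ≤ s'.real 2 (s.nat 11 0) ∧
      ∀ j < m, s.real 2 (s.nat 11 0) + inputWeight s (s.nat 16 0 + j) ≤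
        s'.real 2 (s.nat 11 0)) (by decide) ?_ ?_ ?_ fun s' h => h).mono ?_ fun s' _ h => h
  · intro s' hA
    simp [hA.1 0 (by decide), h]
  · simp
  · intro m s' hm hA hx hI
    have e16 := hA.1 16 (by decide)
    have e17 := hA.1 17 (by decide)
    have e11 := hA.1 11 (by decide)
    have e1 := hA.1 1 (by decide)
    have r0 := hA.2 0 (by decide)
    obtain ⟨I1, I2, I3, I4, I5⟩ := hI
    have hv := inputWeight_nonneg s (s.nat 16 0 + m)
    set v := inputWeight s (s.nat 16 0 + m) with hvdef
    refine Runs.seq (T := 40) (T' := 40) (Q := fun s₁ =>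
      s₁ = s'.setReal 1 (s.nat 17 0 + (m + 1)) v) (Runs.of_exec (by decide) (by decide) ?_) ?_
    · simp only [Program.exec, Test.Holds, NatExpr.eval, RealExpr.eval, hx, e16, e17, e1, r0, hvdef,
        inputWeight]
      split_ifs <;> rfl
    rintro s₁ - rfl
    refine Runs.of_exec (by decide) (by decide) ?_
    simp [hx, e17, e11, Function.update_apply]
    refine ⟨fun c hc => ?_, fun j hj => ?_, fun i hi => ?_, by linarith, fun j hj => ?_⟩
    · rw [if_neg (by omega), I1 c hc]
    · by_cases hjm : j = m
      · simp [hjm, hvdef]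
      · rw [if_neg hjm, I2 j (by omega)]
    · rw [if_neg hi, I3 i hi]
    · by_cases hjm : j = m
      · subst hjm
        linarith
      · linarith [I5 j (by omega)]
  · exact Nat.mul_le_mul_left _ (by decide)

theorem runs_readInput (hk : s.nat 0 0 = k) (hl : s.nat 0 1 = l) :
    Runs readInput s ((k + 2) * ((l + 2) * 200)) fun s' =>
      HoldsMatrix k l (inputMatrix l s) s' ∧
      ∀ i < k, ∀ j ≤ l, inputMatrix l s i j ≤ s'.real 2 i := by
  refine Runs.mono (T := 3 + (3 + (k + 1) * (((l + 1) * 100 + 80) + 13))) ?_ ?_ fun _ _ h => h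
  swap
  · nlinarith [Nat.zero_le (k * l)]
  refine Runs.seq (Q := fun s₁ => s₁ = s.setNat 16 0 0)
    (Runs.of_exec (by decide) (by decide) (by simp)) ?_
  rintro s₁ - rfl
  refine Runs.seq (Q := fun s₁ => s₁ = (s.setNat 16 0 0).setNat 17 0 0)
    (Runs.of_exec (by decide) (by decide) (by simp)) ?_
  rintro s₁ - rfl
  set s₀ := (s.setNat 16 0 0).setNat 17 0 0 with hs₀
  have a0 : s₀.nat 0 = s.nat 0 := by simp [hs₀]
  have a1 : s₀.nat 1 = s.nat 1 := by simp [hs₀]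
  have ar : s₀.real 0 = s.real 0 := by simp [hs₀]
  refine (Runs.forLoop_const k ((l + 1) * 100 + 80) (fun m s' =>
      s'.nat 16 0 = m * l ∧ s'.nat 17 0 = m * (l + 1) ∧
      (∀ i < m, s'.nat 3 i = i * (l + 1)) ∧
      (∀ i < m, ∀ j ≤ l, s'.real 1 (i * (l + 1) + j) = inputMatrix l s i j) ∧
      ∀ i < m, ∀ j ≤ l, inputMatrix l s i j ≤ s'.real 2 i) (by decide) ?_ ?_ ?_
      fun s' h => h).mono ?_ ?_
  · intro s' hA
    simp [hA.1 0 (by decide), a0, hk]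
  · simp [hs₀]
  · rintro m s' hm hA hx ⟨I1, I2, I3, I4, I5⟩
    have e0 := hA.1 0 (by decide)
    have e1 := hA.1 1 (by decide)
    have r0 := hA.2 0 (by decide)
    refine Runs.mono (T := 10 + (10 + (10 + ((l + 1) * 100 + (10 + 20))))) ?_ (by omega)
      fun _ _ h => h
    refine Runs.seq (Q := fun s₁ => s₁ = s'.setNat 3 m (m * (l + 1)))
      (Runs.of_exec (by decide) (by decide) (by simp [hx, I2])) ?_
    rintro s₁ - rfl
    refine Runs.seq (Q := fun s₁ => s₁ = (s'.setNat 3 m (m * (l + 1))).setReal 2 m 0)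
      (Runs.of_exec (by decide) (by decide) (by simp [hx])) ?_
    rintro s₁ - rfl
    refine Runs.seq (Q := fun s₁ => s₁ = ((s'.setNat 3 m (m * (l + 1))).setReal 2 m 0).setReal 1
      (m * (l + 1)) 0) (Runs.of_exec (by decide) (by decide) (by simp [I2])) ?_
    rintro s₁ - rfl
    set s₁ := ((s'.setNat 3 m (m * (l + 1))).setReal 2 m 0).setReal 1 (m * (l + 1)) 0 with hs₁
    refine Runs.seq (runs_readRow (l := l) (by simp [hs₁, e0, a0, hl])) ?_
    rintro s₂ hA₂ ⟨J1, J2, J3, J4, J5⟩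
    have b16 : s₁.nat 16 0 = m * l := by simp [hs₁, I1]
    have b17 : s₁.nat 17 0 = m * (l + 1) := by simp [hs₁, I2]
    have b11 : s₁.nat 11 0 = m := by simp [hs₁, hx]
    have b2 : s₁.real 2 m = 0 := by simp [hs₁]
    have bw : ∀ c, inputWeight s₁ c = inputWeight s c := fun c => by
      simp [inputWeight, hs₁, e1, a1, r0, ar]
    simp only [b16, b17, b11, b2, bw, zero_add] at J1 J2 J3 J4 J5
    have c0 : s₂.nat 0 1 = l := by rw [hA₂.1 0 (by decide)]; simp [hs₁, e0, a0, hl]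
    have c3 : s₂.nat 3 = Function.update (s'.nat 3) m (m * (l + 1)) := by
      rw [hA₂.1 3 (by decide)]; simp [hs₁]
    have c16 : s₂.nat 16 0 = m * l := by rw [hA₂.1 16 (by decide), b16]
    have c17 : s₂.nat 17 0 = m * (l + 1) := by rw [hA₂.1 17 (by decide), b17]
    refine Runs.mono (T := 30) (Runs.of_exec (by decide) (by decide) (Q := fun s₃ => _) ?_)
      (by omega) fun _ _ h => h
    simp [c0, c3, c16, c17]
    refine ⟨by ring, by ring, fun i hi => ?_, fun i hi j hj => ?_, fun i hi j hj => ?_⟩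
    · by_cases him : i = m
      · simp [him]
      · rw [Function.update_of_ne him, I3 i (by omega)]
    · by_cases him : i = m
      · subst him
        obtain _ | j := j
        · rw [J1 _ (by omega)]
          simp [hs₁, inputMatrix]
        · rw [J2 j hj]
          simp [inputMatrix]
      · have : i * (l + 1) + j < m * (l + 1) := by
          have : (i + 1) * (l + 1) ≤ m * (l + 1) := Nat.mul_le_mul_right _ (by omega)
          nlinarith
        rw [J1 _ this.le, ← I4 i (by omega) j hj]
        simp [hs₁, this.ne]
    · by_cases him : i = m
      · subst him
        obtain _ | j := j
        · simpa [inputMatrix] using J4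
        · simpa [inputMatrix] using J5 j hj
      · rw [J3 i him]
        simpa [hs₁, him] using I5 i (by omega) j hj
  · simp [NatExpr.cost]
  · rintro s' hA ⟨I1, I2, I3, I4, I5⟩
    have e0 := hA.1 0 (by decide)
    refine ⟨⟨by rw [e0, a0, hk], by rw [e0, a0, hl], fun i hi j hj => ?_⟩, I5⟩
    rw [I3 i hi, I4 i hi j hj]

theorem runs_clearColumns (hl : s.nat 0 1 = l)
    (hW : ∀ i < k, ∀ j ≤ l, W i j ≤ s.real 2 i) :
    Runs clearColumns s ((l + 3) * 100) fun s' =>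
      HoldsGood k l 0 (l + 1) W s' ∧ s'.nat 4 (l + 1) = 0 := by
  refine (Runs.forLoop_const (l + 2) 80 (fun m s' => ∀ j < m, s'.nat 4 j = 0 ∧ s'.real 3 j = 0)
    (by decide) ?_ ?_ ?_ fun s' h => h).mono ?_ ?_
  · intro s' hA
    simp [hA.1 0 (by decide), hl]
  · simp
  · intro m s' hm hA hx hI
    refine Runs.of_exec (by decide) (by decide) ?_
    simp [hx, Function.update_apply]
    intro j hj
    by_cases hjm : j = m
    · simp [hjm]
    · simpa [hjm] using hI j (by omega)
  · simp [NatExpr.cost]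
  · intro s' hA hI
    have r2 := hA.2 2 (by decide)
    refine ⟨⟨Nat.zero_le _, fun i hi j hj => ?_, (hI 0 (by omega)).2, fun j hj =>
      (hI j (by omega)).2.ge, fun i hi => absurd hi (Nat.not_lt_zero _), fun i hi =>
      absurd hi (Nat.not_lt_zero _), fun j _ hj i => ?_, fun j hj _ _ => (hI j (by omega)).2,
      (hI 0 (by omega)).1⟩, (hI (l + 1) (by omega)).1⟩
    · rw [r2, (hI j (by omega)).2, add_zero]
      exact hW i hi j hj
    · simp [(hI j (by omega)).1]

theorem runs_insertRows (h : HoldsMatrix k l W s) (hg : HoldsGood k l 0 (l + 1) W s)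
    (hp : s.nat 4 (l + 1) = 0) :
    Runs insertRows s ((k + 1) * ((l + 3) * ((min k (l + 1) + 1) * 1100))) fun s' =>
      HoldsGood k l k (l + 1) W s' ∧ s'.nat 4 (l + 1) = 0 := by
  refine (Runs.forLoop_const k (50 + (l + 3) * ((min k (l + 1) + 1) * 1000)) (fun m s' =>
    HoldsGood k l m (l + 1) W s' ∧ s'.nat 4 (l + 1) = 0) (by decide) ?_ ?_ ?_
    fun s' h => h).mono ?_ fun s' _ h => h
  · intro s' hA
    simp [hA.1 0 (by decide), h.1]
  · simp [HoldsGood, hp]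
    simpa [HoldsGood] using hg
  · rintro m s' hm hA hx ⟨I1, I2⟩
    have e0 := hA.1 0 (by decide)
    have hl : s'.nat 0 1 = l := by rw [e0, h.2.1]
    refine Runs.seq (Q := fun s₁ => s₁ = ((s'.setNat 4 (l + 1) (m + 1)).setNat 5 m (l + 1)).setNat
      14 0 (l + 1)) (Runs.of_exec (by decide) (by decide) (by simp [hl, hx])) ?_
    rintro s₁ - rfl
    refine (runs_reassign (k := k) (l := l) (R := m + 1) (b := l + 1) (W := W)
      (h.congr ?_ ?_ ?_) ?_ (by simp) (by omega) le_rfl (by simp)).mono le_rfl ?_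
    · simp [e0]
    · simp [hA.1 3 (by decide)]
    · simp [hA.2 1 (by decide)]
    · simp only [HoldsGood, State.setNat_real, State.setNat_nat_self, ne_eq, Nat.reduceEqDiff,
        not_false_eq_true, State.setNat_nat_of_ne]
      exact Good.insert I1 hm I2 (fun j => by rw [Function.update_apply])
        fun i => by rw [Function.update_apply]
    · intro s₂ _ hs₂
      simpa [HoldsGood] using hs₂
  · refine Nat.mul_le_mul_left _ ?_
    have : (l + 3) * 1 ≤ (l + 3) * (min k (l + 1) + 1) := Nat.mul_le_mul_left _ (by omega)
    have h1 : (l + 3) * ((min k (l + 1) + 1) * 1000) = 1000 * ((l + 3) * (min k (l + 1) + 1)) := by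
      ring
    have h2 : (l + 3) * ((min k (l + 1) + 1) * 1100) = 1100 * ((l + 3) * (min k (l + 1) + 1)) := by
      ring
    rw [h1, h2]
    simp only [NatExpr.cost]
    omega

/-- A loop that copies an array of naturals and an array of reals. -/
theorem runs_copy {a a' c c' N : ℕ} {e : NatExpr} (ha : a ≠ a') (hc : c ≠ c') (ha10 : a ≠ 10)
    (ha' : a' ≠ 10)
    (he : ∀ s', Agree (forLoop 10 e (.seq (.natSet a (var 10) (.read a' (var 10)))
      (.realSet c (var 10) (.read c' (var 10))))) s s' → e.eval s' = N) :
    Runs (forLoop 10 e (.seq (.natSet a (var 10) (.read a' (var 10)))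
      (.realSet c (var 10) (.read c' (var 10))))) s ((N + 1) * (50 + (e.cost + 10))) fun s' =>
      ∀ j < N, s'.nat a j = s.nat a' j ∧ s'.real c j = s.real c' j := by
  refine (Runs.forLoop_const N 50 (fun m s' => ∀ j < m, s'.nat a j = s.nat a' j ∧
    s'.real c j = s.real c' j) ?_ he ?_ ?_ fun s' h => h)
  · simp [Program.natWrites, Ne.symm ha10]
  · simp
  · intro m s' hm hA hx hI
    refine Runs.of_exec rfl (by simp [Program.bound, NatExpr.cost, RealExpr.cost]) ?_
    have e1 : s'.nat a' = s.nat a' := hA.1 a' (by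
      simp [Program.natWrites, Ne.symm ha, ha'])
    have e2 : s'.real c' = s.real c' := hA.2 c' (by simp [Program.realWrites, Ne.symm hc])
    simp [hx, e1, e2, ha10, Ne.symm ha10, Function.update_apply]
    intro j hj
    by_cases hjm : j = m
    · simp [hjm]
    · simpa [hjm] using hI j (by omega)

theorem runs_writeMatching (h : HoldsMatrix k l W s) (hq : ∀ i < k, s.nat 5 i ≤ l) :
    Runs writeMatching s ((k + 1) * 60) fun s' =>
      (∀ c < s.nat 17 0, s'.nat 2 c = s.nat 2 c) ∧ ∀ i < k, s'.nat 2 (s.nat 17 0 + i) =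
        open Classical in if 0 < W i (s.nat 5 i) then s.nat 5 i else 0 := by
  classical
  refine (Runs.forLoop_const k 40 (fun m s' => (∀ c < s.nat 17 0, s'.nat 2 c = s.nat 2 c) ∧
    ∀ i < m, s'.nat 2 (s.nat 17 0 + i) =
      if 0 < W i (s.nat 5 i) then s.nat 5 i else 0) (by decide) ?_ ?_ ?_
    fun s' h => h).mono ?_ fun s' _ h => ⟨h.1, fun i hi => by convert h.2 i hi⟩
  · intro s' hA
    simp [hA.1 0 (by decide), h.1]
  · simp
  · rintro m s' hm hA hx ⟨I1, I2⟩
    refine Runs.of_exec (by decide) (by decide) ?_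
    have e17 := hA.1 17 (by decide)
    have e3 := hA.1 3 (by decide)
    have e5 := hA.1 5 (by decide)
    have r1 := hA.2 1 (by decide)
    have hW := h.2.2 m hm _ (hq m hm)
    simp [hx, e17, e3, e5, r1, hW]
    split_ifs with h0
    all_goals
      simp [Function.update_apply]
      refine ⟨fun c hc => ?_, fun i hi => ?_⟩
      · rw [if_neg (by omega), I1 c hc]
      · by_cases him : i = m
        · simp [him, h0]
        · rw [if_neg him, I2 i (by omega)]
  · exact Nat.mul_le_mul_left _ (by decide)

end RealRAM

/-! ### Deleting the columns one at a time. -/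

open Hungarian in
theorem Hungarian.Good.congr {k l b : ℕ} {W : ℕ → ℕ → ℝ} {y z y' z' : ℕ → ℝ} {p q p' q' : ℕ → ℕ}
    (h : Good k l k b W y z p q) (hk : ∀ i < k, q' i = q i ∧ y' i = y i)
    (hl : ∀ j ≤ l + 1, p' j = p j ∧ z' j = z j) : Good k l k b W y' z' p' q' := by
  refine ⟨le_rfl, fun i hi j hj => ?_, ?_, fun j hj => ?_, fun i hi => ?_, fun i hi => ?_,
    fun j h0 hj i => ?_, fun j hj => ?_, ?_⟩
  · rw [(hk i hi).2, (hl j (by omega)).2]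
    exact h.feas i hi j hj
  · rw [(hl 0 (by omega)).2, h.z_zero]
  · rw [(hl j (by omega)).2]
    exact h.z_nonneg j hj
  · rw [(hk i hi).1]
    exact h.q_le i hi
  · rw [(hk i hi).1, (hk i hi).2]
    intro hb
    obtain ⟨h1, h2⟩ := h.tight i hi hb
    exact ⟨h1, by rw [(hl _ (by omega)).2, h2]⟩
  · rw [(hl j hj).1, h.p_iff j h0 hj]
    exact and_congr_right fun hi => by rw [(hk i hi).1]
  · rw [(hl j (by omega)).1, (hl j (by omega)).2]
    exact h.free j hj
  · rw [(hl 0 (by omega)).1, h.p_zero]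

namespace RealRAM

open Hungarian

variable {k l R b n : ℕ} {W : ℕ → ℕ → ℝ} {s : State}

theorem runs_save (h : HoldsMatrix k l W s) (hg : HoldsGood k l k (l + 1) W s)
    (hp : s.nat 4 (l + 1) = 0) :
    Runs (.seq saveRows saveColumns) s ((k + l + 4) * 70) fun s' =>
      Good k l k (l + 1) W (s'.real 5) (s'.real 6) (s'.nat 8) (s'.nat 9) ∧
        s'.nat 8 (l + 1) = 0 := by
  refine Runs.mono (T := (k + 1) * (50 + 12) + (l + 2 + 1) * (50 + 14)) ?_ (by omega)
    fun _ _ h => h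
  refine Runs.seq (runs_copy (N := k) (by decide) (by decide) (by decide) (by decide)
    fun s' hA => by simp [hA.1 0 (by decide), h.1]) ?_
  intro s₁ hA₁ h₁
  refine (runs_copy (N := l + 2) (by decide) (by decide) (by decide) (by decide)
    fun s' hA => by simp [hA.1 0 (by decide), hA₁.1 0 (by decide), h.2.1]).mono le_rfl ?_
  intro s₂ hA₂ h₂
  rw [hA₁.1 4 (by decide), hA₁.2 3 (by decide)] at h₂
  refine ⟨hg.congr (fun i hi => ?_) fun j hj => h₂ j (by omega), ?_⟩
  · rw [hA₂.1 9 (by decide), hA₂.2 5 (by decide)]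
    exact h₁ i hi
  · rw [(h₂ (l + 1) (by omega)).1, hp]

/-- The column that is missing in the graph with number `r`. -/
def deletedColumn (l r : ℕ) : ℕ := if r = 0 then l + 1 else r

/-- The memory contains an optimal assignment without the column `b`. -/
def HoldsAssignment (k l b : ℕ) (W : ℕ → ℕ → ℝ) (q : ℕ → ℕ) : Prop :=
  ∃ y z p, Good k l k b W y z p q ∧ p b = 0

theorem runs_deleteColumn {m : ℕ} (h : HoldsMatrix k l W s)
    (hg : Good k l k (l + 1) W (s.real 5) (s.real 6) (s.nat 8) (s.nat 9))
    (hp : s.nat 8 (l + 1) = 0) (hm : s.nat 11 0 = m) (hml : m ≤ l) :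
    Runs (.seq restoreRows (.branch (.natLt (.const 0) (.read 8 (var 11)))
          (.seq restoreColumns (.seq (assign 14 (var 11)) reassign)) .skip)) s
      ((k + 1) * 80 + if s.nat 8 m = 0 then 0 else (l + 3) * ((min k (l + 1) + 1) * 1100))
      fun s' => HoldsAssignment k l (deletedColumn l m) W (s'.nat 5) := by
  refine Runs.mono (T := (k + 1) * (50 + 12) + (7 + if s.nat 8 m = 0 then 0 else
    (l + 3) * ((min k (l + 1) + 1) * 1100))) ?_ (by omega) fun _ _ h => h
  refine Runs.seq (runs_copy (N := k) (by decide) (by decide) (by decide) (by decide)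
    fun s' hA => by simp [hA.1 0 (by decide), h.1]) ?_
  intro s₁ hA₁ h₁
  have e8 := hA₁.1 8 (by decide)
  have e11 := hA₁.1 11 (by decide)
  by_cases hpm : s.nat 8 m = 0
  · refine Runs.branch (T := 1) (fun hb => ?_) (fun _ => Runs.of_exec (by decide) (by decide) ?_) ?_
    · simp [e8, e11, hm, hpm] at hb
    -- Only the rows were restored, so the column arrays may be stale; the certificate is taken from
    -- the saved copies.
    · refine ⟨s.real 5, s.real 6, s.nat 8, ?_, ?_⟩
      · have hg' : Good k l k (deletedColumn l m) W (s.real 5) (s.real 6) (s.nat 8) (s.nat 9) :=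
          hg.change_deleted hp _
        exact hg'.congr (fun i hi => ⟨(h₁ i hi).1, rfl⟩) fun _ _ => ⟨rfl, rfl⟩
      · unfold deletedColumn
        split_ifs
        exacts [hp, hpm]
    · simp [Test.cost, NatExpr.cost]
  · have hm0 : m ≠ 0 := fun h0 => hpm (by rw [h0, hg.p_zero])
    refine Runs.branch (T := (l + 2 + 1) * (50 + 14) + (10 + (l + 3) *
      ((min k (l + 1) + 1) * 1000))) (fun _ => ?_) (fun hb => ?_) ?_
    · refine Runs.seq (runs_copy (N := l + 2) (by decide) (by decide) (by decide) (by decide)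
        fun s' hA => by simp [hA.1 0 (by decide), hA₁.1 0 (by decide), h.2.1]) ?_
      intro s₂ hA₂ h₂
      refine Runs.seq (Q := fun s₃ => s₃ = s₂.setNat 14 0 m)
        (Runs.of_exec (by decide) (by decide) (by simp [hA₂.1 11 (by decide), e11, hm])) ?_
      rintro s₃ - rfl
      rw [e8, hA₁.2 6 (by decide)] at h₂
      refine (runs_reassign (k := k) (l := l) (R := k) (b := m) (W := W) (h.congr ?_ ?_ ?_) ?_
        (by simp) hm0 (by omega) ?_).mono le_rfl ?_
      · simp [hA₂.1 0 (by decide), hA₁.1 0 (by decide)]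
      · simp [hA₂.1 3 (by decide), hA₁.1 3 (by decide)]
      · simp [hA₂.2 1 (by decide), hA₁.2 1 (by decide)]
      · simp [HoldsGood]
        rw [hA₂.1 5 (by decide), hA₂.2 2 (by decide)]
        exact (hg.change_deleted hp m).congr h₁ fun j hj => h₂ j (by omega)
      · simpa [(h₂ m (by omega)).1] using hpm
      · rintro s₄ - ⟨h3, h4⟩
        rw [deletedColumn, if_neg hm0]
        exact ⟨_, _, _, h3, h4⟩
    · simp [e8, e11, hm, hpm] at hb
    · rw [if_neg hpm]
      have : (l + 3) * 1 ≤ (l + 3) * (min k (l + 1) + 1) := Nat.mul_le_mul_left _ (by omega)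
      have h1 : (l + 3) * ((min k (l + 1) + 1) * 1000) =
        1000 * ((l + 3) * (min k (l + 1) + 1)) := by ring
      have h2 : (l + 3) * ((min k (l + 1) + 1) * 1100) =
        1100 * ((l + 3) * (min k (l + 1) + 1)) := by ring
      rw [h1, h2]
      simp only [Test.cost, NatExpr.cost]
      omega

/-- Assigned columns have distinct rows. This limits the number of searches in the deletion phase.
-/
theorem card_matched_le {p q : ℕ → ℕ} {y z : ℕ → ℝ}
    (hg : Good k l k b W y z p q) :
    ((Finset.range (l + 1)).filter fun m => ¬ p m = 0).card ≤ min k (l + 1) := by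
  refine le_min ?_ ((Finset.card_filter_le _ _).trans (by simp))
  rw [← Finset.card_range k]
  refine (Finset.card_le_card ?_).trans (Finset.card_image_le (s := Finset.range k) (f := q))
  intro m hm
  simp only [Finset.mem_filter, Finset.mem_range] at hm
  obtain ⟨i, hi⟩ := Nat.exists_eq_succ_of_ne_zero hm.2
  have hm0 : m ≠ 0 := fun h0 => hm.2 (by rw [h0, hg.p_zero])
  obtain ⟨h1, h2⟩ := (hg.p_iff m hm0 (by omega) i).1 hi
  exact Finset.mem_image.2 ⟨i, Finset.mem_range.2 h1, h2⟩

theorem deletedColumn_ne_zero (l r : ℕ) : deletedColumn l r ≠ 0 := by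
  unfold deletedColumn
  split_ifs <;> omega

theorem deletedColumn_le {r : ℕ} (hr : r ≤ l) : deletedColumn l r ≤ l + 1 := by
  unfold deletedColumn
  split_ifs <;> omega

/-- The output with number `r` is an optimal assignment without a column. -/
def OutputOptimal (k l : ℕ) (W : ℕ → ℕ → ℝ) (s : State) (r : ℕ) : Prop :=
  ∃ q, HoldsAssignment k l (deletedColumn l r) W q ∧ ∀ i < k, s.nat 2 (r * k + i) =
    open Classical in if 0 < W i (q i) then q i else 0

theorem runs_deleteColumns (h : HoldsMatrix k l W s)
    (hg : Good k l k (l + 1) W (s.real 5) (s.real 6) (s.nat 8) (s.nat 9))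
    (hp : s.nat 8 (l + 1) = 0) (h17 : s.nat 17 0 = 0) :
    Runs deleteColumns s ((l + 2) * ((k + 1) * 200) +
      min k (l + 1) * ((l + 3) * ((min k (l + 1) + 1) * 1100)))
      fun s' => ∀ r ≤ l, OutputOptimal k l W s' r := by
  refine (Runs.forLoop (l + 1) (fun m => (k + 1) * 180 + if s.nat 8 m = 0 then 0 else
      (l + 3) * ((min k (l + 1) + 1) * 1100)) (fun m s' => s'.nat 17 0 = m * k ∧
      ∀ r < m, OutputOptimal k l W s' r) (by decide) ?_ ?_ ?_ fun s' h => h).mono ?_ ?_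
  · intro s' hA
    simp [hA.1 0 (by decide), h.2.1]
  · simp [h17]
  · rintro m s' hm hA hx ⟨I1, I2⟩
    have e8 := hA.1 8 (by decide)
    have e0 := hA.1 0 (by decide)
    have hM : HoldsMatrix k l W s' := h.congr e0 (hA.1 3 (by decide)) (hA.2 1 (by decide))
    have hdel := runs_deleteColumn (m := m) hM
      (by rwa [hA.2 5 (by decide), hA.2 6 (by decide), e8, hA.1 9 (by decide)])
      (by rwa [e8]) hx (by omega)
    rw [e8] at hdel
    obtain ⟨t₁, s₁, ex₁, ht₁, h₁⟩ := hdel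
    have hA₁ := ex₁.agree
    have hq : ∀ i < k, s₁.nat 5 i ≤ l := by
      obtain ⟨y, z, p, hg₁, hp₁⟩ := h₁
      exact fun i hi => (hg₁.tight i hi (hg₁.q_ne (deletedColumn_ne_zero l m)
        (deletedColumn_le (by omega)) hp₁ hi)).1
    have hM₁ : HoldsMatrix k l W s₁ :=
      hM.congr (hA₁.1 0 (by decide)) (hA₁.1 3 (by decide)) (hA₁.2 1 (by decide))
    obtain ⟨t₂, s₂, ex₂, ht₂, h₂, h₂'⟩ := runs_writeMatching hM₁ hq
    have hA₂ := ex₂.agree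
    have ex₃ := Exec.natSet 17 (.const 0) (.add (var 17) leftSize) s₂
    have e17 : s₁.nat 17 0 = m * k := by rw [hA₁.1 17 (by decide), I1]
    have e17' : s₂.nat 17 0 = m * k := by rw [hA₂.1 17 (by decide), e17]
    have e0' : s₂.nat 0 0 = k := by rw [hA₂.1 0 (by decide), hM₁.1]
    rw [e17] at h₂ h₂'
    -- Reassociates the sequence: the loop body nests to the right, whereas the preceding lemma
    -- groups its first two commands.
    cases ex₁ with
    | seq exa exb =>
    refine ⟨_, _, exa.seq (exb.seq (ex₂.seq ex₃)), ?_, ?_⟩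
    · simp only [NatExpr.cost]
      omega
    · simp only [State.setNat_nat_self, NatExpr.eval, e17', e0', ne_eq, Nat.reduceEqDiff,
        not_false_eq_true, State.setNat_nat_of_ne, Function.update_self]
      refine ⟨by ring, fun r hr => ?_⟩
      by_cases hrm : r = m
      · subst hrm
        exact ⟨_, h₁, by simpa using h₂'⟩
      · obtain ⟨q, hq, ho⟩ := I2 r (by omega)
        refine ⟨q, hq, fun i hi => ?_⟩
        have : r * k + i < m * k := by
          have : (r + 1) * k ≤ m * k := Nat.mul_le_mul_right _ (by omega)
          nlinarith
        simp only [ne_eq, Nat.reduceEqDiff, not_false_eq_true, State.setNat_nat_of_ne]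
        rw [h₂ _ this, hA₁.1 2 (by decide)]
        exact ho i hi
  · have hc := card_matched_le hg
    set X := (l + 3) * ((min k (l + 1) + 1) * 1100)
    -- Only assigned columns pay for a search.
    have h1 : ∑ m ∈ Finset.range (l + 1), (if s.nat 8 m = 0 then 0 else X) ≤ min k (l + 1) * X := by
      rw [Finset.sum_ite, Finset.sum_const_zero, zero_add, Finset.sum_const, smul_eq_mul]
      exact Nat.mul_le_mul_right _ hc
    rw [Finset.sum_add_distrib, Finset.sum_add_distrib, Finset.sum_const, Finset.sum_const,
      Finset.card_range, smul_eq_mul, smul_eq_mul]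
    simp only [NatExpr.cost]
    nlinarith [Nat.zero_le (l * k)]
  · rintro s' - ⟨-, I⟩ r hr
    exact I r (by omega)

/-! ### The total running time. -/

theorem runs_allMatchings (hk : s.nat 0 0 = k) (hl : s.nat 0 1 = l) :
    Runs allMatchings s ((k + 2) * ((l + 2) * 200) + ((l + 3) * 100 +
      ((k + 1) * ((l + 3) * ((min k (l + 1) + 1) * 1100)) + ((k + l + 4) * 70 + (3 +
        ((l + 2) * ((k + 1) * 200) +
          min k (l + 1) * ((l + 3) * ((min k (l + 1) + 1) * 1100))))))))
      fun s' => ∀ r ≤ l, OutputOptimal k l (inputMatrix l s) s' r := by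
  refine Runs.seq (runs_readInput hk hl) fun s₁ _ ⟨hM₁, hy⟩ => ?_
  refine Runs.seq (runs_clearColumns hM₁.2.1 hy) fun s₂ hA₂ ⟨hg₂, hp₂⟩ => ?_
  have hM₂ := hM₁.congr (hA₂.1 0 (by decide)) (hA₂.1 3 (by decide)) (hA₂.2 1 (by decide))
  refine Runs.seq (runs_insertRows hM₂ hg₂ hp₂) fun s₃ hA₃ ⟨hg₃, hp₃⟩ => ?_
  have hM₃ := hM₂.congr (hA₃.1 0 (by decide)) (hA₃.1 3 (by decide)) (hA₃.2 1 (by decide))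
  have hsave := runs_save hM₃ hg₃ hp₃
  obtain ⟨t, s₄, ex, ht, hg₄, hp₄⟩ := hsave
  have hA₄ := ex.agree
  have hM₄ := hM₃.congr (hA₄.1 0 (by decide)) (hA₄.1 3 (by decide)) (hA₄.2 1 (by decide))
  have ex₅ := Exec.natSet 17 (.const 0) (.const 0) s₄
  obtain ⟨t', s₆, ex₆, ht', h₆⟩ := runs_deleteColumns (s := s₄.setNat 17 0 0)
    (hM₄.congr (by simp) (by simp) (by simp)) (by simpa using hg₄) (by simpa using hp₄) (by simp)
  cases ex with
  | seq exa exb =>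
  refine ⟨_, s₆, exa.seq (exb.seq (ex₅.seq ex₆)), ?_, h₆⟩
  simp only [NatExpr.cost]
  omega

theorem OutputOptimal.isMaxWeightMatching {B : SimpleGraph (Fin k ⊕ Fin l)}
    {w : Sym2 (Fin k ⊕ Fin l) → ℝ} {r : ℕ} (h : OutputOptimal k l W s r) (hr : r ≤ l)
    (hW : IsWeightMatrix B w W) (hB : B ≤ completeBipartiteGraph (Fin k) (Fin l)) (H : B.Subgraph)
    (hH : ∀ i j, H.Adj (.inl i) (.inr j) ↔
      B.Adj (.inl i) (.inr j) ∧ (j : ℕ) + 1 ≠ deletedColumn l r) :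
    IsMaxWeightMatching H w (s.output k l r) := by
  obtain ⟨q, ⟨y, z, p, hg, hp⟩, hs⟩ := h
  exact hg.isMaxWeightMatching (deletedColumn_ne_zero l r) (deletedColumn_le hr) hp hW hB H hH s r
    fun i hi => by convert hs i hi

/-- Additive constants are absorbed through `k + 2 ≤ 3 * k`, `l + 3 ≤ 3 * l` and `min k (l + 1) + 1
≤ 3 * min k l`; the constant `100000` is generous. -/
theorem time_le (hk : 1 ≤ k) (hl : 2 ≤ l) :
    (k + 2) * ((l + 2) * 200) + ((l + 3) * 100 +
      ((k + 1) * ((l + 3) * ((min k (l + 1) + 1) * 1100)) + ((k + l + 4) * 70 + (3 +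
        ((l + 2) * ((k + 1) * 200) +
          min k (l + 1) * ((l + 3) * ((min k (l + 1) + 1) * 1100))))))) ≤
      100000 * (k * l * min k l) := by
  have hm : 1 ≤ min k l := le_min hk (by omega)
  have h1 : min k (l + 1) + 1 ≤ 3 * min k l := by omega
  have h2 : min k (l + 1) ≤ k := min_le_left _ _
  generalize min k l = μ at *
  generalize min k (l + 1) = ν at *
  have a1 : (k + 2) * ((l + 2) * 200) ≤ (3 * k) * ((2 * l) * 200) := by gcongr <;> omega
  have a2 : (k + 1) * ((l + 3) * ((ν + 1) * 1100)) ≤ (2 * k) * ((3 * l) * ((3 * μ) * 1100)) := by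
    gcongr <;> omega
  have a3 : (l + 2) * ((k + 1) * 200) ≤ (2 * l) * ((2 * k) * 200) := by gcongr <;> omega
  have a4 : ν * ((l + 3) * ((ν + 1) * 1100)) ≤ k * ((3 * l) * ((3 * μ) * 1100)) := by
    gcongr; omega
  have b1 : k * l ≤ k * l * μ := Nat.le_mul_of_pos_right _ hm
  have b2 : k ≤ k * l := Nat.le_mul_of_pos_right _ (by omega)
  have b3 : l ≤ k * l := Nat.le_mul_of_pos_left _ hk
  have c1 : (3 * k) * ((2 * l) * 200) = 1200 * (k * l) := by ring
  have c2 : (2 * k) * ((3 * l) * ((3 * μ) * 1100)) = 19800 * (k * l * μ) := by ring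
  have c3 : (2 * l) * ((2 * k) * 200) = 800 * (k * l) := by ring
  have c4 : k * ((3 * l) * ((3 * μ) * 1100)) = 9900 * (k * l * μ) := by ring
  omega

end RealRAM

/-- One program, for all `k` and `l`, computes maximum weight matchings of a weighted bipartite graph
`B` with sides of sizes `k` and `l ≥ 2` (as output `0`) and of all the induced subgraphs
`B_j = B - u_j` (as outputs `j + 1`) in total time `O(k l (min k l + log (max k l)))`. -/
theorem mainTheorem3 :
    ∃ (P : RealRAM.Program) (C : ℝ), ∀ (k l : ℕ), 2 ≤ l →
      ∀ (B : SimpleGraph (Fin k ⊕ Fin l)), B ≤ completeBipartiteGraph (Fin k) (Fin l) →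
      ∀ (w : Sym2 (Fin k ⊕ Fin l) → ℝ) (s : RealRAM.State), RealRAM.HoldsInput B w s →
        ∃ (t : ℕ) (s' : RealRAM.State), RealRAM.Exec P s t s' ∧
          (1 ≤ k → (t : ℝ) ≤
            C * ((k : ℝ) * (l : ℝ) * (min (k : ℝ) (l : ℝ) + Real.log (max (k : ℝ) (l : ℝ))))) ∧
          IsMaxWeightMatching (⊤ : B.Subgraph) w (s'.output k l 0) ∧
          ∀ j : Fin l,
            IsMaxWeightMatching ((⊤ : B.Subgraph).induce {x | x ≠ Sum.inr j}) w
              (s'.output k l ((j : ℕ) + 1)) := by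
  refine ⟨RealRAM.allMatchings, 100000, fun k l hl B hB w s hs => ?_⟩
  obtain ⟨t, s', ex, ht, ho⟩ := RealRAM.runs_allMatchings hs.1 hs.2.1
  have hW := hs.isWeightMatrix
  refine ⟨t, s', ex, fun hk => ?_, ?_, fun j => ?_⟩
  · have h1 : t ≤ 100000 * (k * l * min k l) := ht.trans (RealRAM.time_le hk hl)
    have h2 : (t : ℝ) ≤ 100000 * ((k : ℝ) * l * min (k : ℝ) l) := by exact_mod_cast h1
    -- The logarithmic term is only needed to be nonnegative.
    have h3 : 0 ≤ Real.log (max (k : ℝ) (l : ℝ)) :=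
      Real.log_nonneg (le_max_of_le_left (by exact_mod_cast hk))
    refine h2.trans ?_
    gcongr
    linarith
  · refine (ho 0 (Nat.zero_le _)).isMaxWeightMatching (Nat.zero_le _) hW hB _ fun i j => ?_
    have := j.2
    simp [RealRAM.deletedColumn, this.ne]
  · refine (ho (j + 1) j.2).isMaxWeightMatching j.2 hW hB _ fun i j' => ?_
    simp [RealRAM.deletedColumn, Fin.ext_iff, and_comm]
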